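/- **Setting.** A network is a finite set $V$ of distinct points (nodes) in the Euclidean plane with distinct identifiers $\mathrm{ID}(u)\in\mathbb N$; $G$ is its unit disk graph ($uv$ is an edge iff $0<|uv|\le 1$). Edges are straight segments. The ID of a directed edge $\overrightarrow{uv}$ is $(|uv|,\mathrm{ID}(u),\mathrm{ID}(v))$, compared lexicographically, and $\mathrm{ID}(uv)=\min\{\mathrm{ID}(\overrightarrow{uv}),\mathrm{ID}(\overrightarrow{vu})\}$. For a graph $Q$ on $V$, $|\mathrm{sp}_Q(u,v)|$ is the length of a shortest path ($\infty$ if there is none). **OrderedYao**$(F)$. (1) Repeatedly remove from $F$ a node of smallest degree in the remaining graph (ties broken by smallest ID); process the nodes in the reverse of this removal order. (2) When $u$ is processed, shoot rays from $u$ through its already processed $F$-neighbors; they split the plane into sectors (one sector of angle $2\pi$ with an arbitrary starting ray if there are none). Divide each sector into the fewest possible open cones of angle at most $\pi/3$. For each cone let $s_1,\dots,s_m$ be the $F$-neighbors of $u$ in it, in angular order; if $m\ge1$, add one shortest edge $us_i$ and all edges $s_js_{j+1}$, $1\le j<m$, to the output. **PLOS**$(G,\varepsilon)$, with $\varepsilon>0$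 and constants $0<\beta\le\frac1{\sqrt2}$, $0<\delta<\frac\beta4$. 1. Let $D$ be the unit Delaunay graph of $V$, that is, the edges of length at most $1$ of a Delaunay triangulation of $V$ (a triangulation such that no circumcircle of one of its triangles has a node in its interior); or, if no four nodes are cocircular, let $D$ be a localized Delaunay graph $\mathrm{LDel}^k(V)$ with $k\ge2$. The edges of $\mathrm{LDel}^k(V)$ are the edges $uv$ of $G$ such that the open disk with diameter $uv$ contains no node, and the edges of all triangles $abc$ in $G$ the interior of whose circumcircle contains no node within $k$ hops in $G$ of $a$, $b$ or $c$. Cover the plane by an axis-parallel grid of closed $\beta\times\beta$ cells, indexed by $(i,j)\in\mathbb Z^2$, such that the centers of adjacent cells are at distance $\beta-2\delta$. Let $V_1,V_2,\dots$ be the sets of nodes in the non-empty cells. 2. For each $i$ let $G_i=(V,E_i)$, where $E_i$ is the set of edges of $D$ with an endpoint in $V_i$, and let $\mathrm{YDel}_i$ be an output of OrderedYao$(G_i)$. Set $\mathrm{YDel}=\bigcup_i \mathrm{YDel}_i$. 3. Start with $H$ edgeless. Visit the four classes of cells with the same parities of $(i,j)$ one after the other, and the cells of a class one by one. At a cell $N$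 let $E_N$ be the set of edges of the current $\mathrm{YDel}$ with both endpoints in $N$, and let $Q$ be the current $\mathrm{YDel}$ without $E_N$. For each $uv\in E_N$ in increasing order of ID: if $|\mathrm{sp}_Q(u,v)|>(1+\varepsilon)|uv|$, add $uv$ to $H$ and to $Q$; otherwise delete $uv$ from $\mathrm{YDel}$. 4. Pick $0\le r\le\frac{\varepsilon\delta}4$ and an $r$-cluster cover of the current $\mathrm{YDel}$: disjoint sets $N_{c}\subseteq V$ covering $V$, with centers $c\in V$, such that $|\mathrm{sp}_{\mathrm{YDel}}(c,v)|\le r$ for all $v\in N_c$ and $|\mathrm{sp}_{\mathrm{YDel}}(c,c')|>r$ for distinct centers $c,c'$. Add to $H$ all edges of the current $\mathrm{YDel}$ that join two centers. Output $H$. **Theorem.** There is an absolute constant $C>0$ such that for every such $V$, $\varepsilon$, $\beta$, $\delta$, every position of the grid, and every way in which the choices left open in the algorithm are made: - every graph $\mathrm{YDel}_i$ has maximum degree at most $25$; - every node is an endpoint of an edge in at most $C/\beta^2$ of the graphs $\mathrm{YDel}_i$ (counted by cells); - the output $H$ has maximum degree at most $25\,C/\beta^2$; in particular, for fixed $\beta$,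 it has maximum degree $O(1)$, with a bound independent of $V$, $\varepsilon$ and $\delta$. -/

import Mathlib

namespace PLOS

noncomputable section

/-- The Euclidean plane. -/
abbrev Plane : Type := EuclideanSpace ℝ (Fin 2)

universe u

/-! ### Geometric graphs

A network is a finite type `V` of nodes, an injective map `pos : V → Plane` giving the
coordinates, and an injective map `ID : V → ℕ` giving the identifiers. -/

/-- The unit disk graph: distinct nodes are joined iff their distance is at most `1`. -/
def unitDiskGraph {V : Type u} (pos : V → Plane) : SimpleGraph V where
  Adj a b := a ≠ b ∧ dist (pos a) (pos b) ≤ 1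
  symm := ⟨fun a b h => ⟨h.1.symm, by rw [dist_comm]; exact h.2⟩⟩
  loopless := ⟨fun _ h => h.1 rfl⟩

/-- A graph drawn with straight segments is plane: no edge passes through a node other than
its endpoints, and two distinct edges share no point other than a common endpoint. -/
def IsPlane {V : Type u} (pos : V → Plane) (T : SimpleGraph V) : Prop :=
  (∀ a b v, T.Adj a b → pos v ∈ segment ℝ (pos a) (pos b) → v = a ∨ v = b) ∧
  (∀ a b c d, T.Adj a b → T.Adj c d → s(a, b) ≠ s(c, d) →
    ∀ x ∈ segment ℝ (pos a) (pos b) ∩ segment ℝ (pos c) (pos d),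
      ∃ v, v ∈ s(a, b) ∧ v ∈ s(c, d) ∧ x = pos v)

/-- A triangulation of the node set: a plane graph to which no edge can be added. -/
def IsTriangulation {V : Type u} (pos : V → Plane) (T : SimpleGraph V) : Prop :=
  IsPlane pos T ∧ ∀ T' : SimpleGraph V, IsPlane pos T' → T ≤ T' → T' = T

/-- A Delaunay triangulation: a triangulation in which the circumcircle of each triangle (three
pairwise adjacent nodes spanning a triangle that contains no further node) has no node in
its interior. With cocircular nodes there may be several of them. -/
def IsDelaunayTriangulation {V : Type u} (pos : V → Plane) (T : SimpleGraph V) : Prop :=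
  IsTriangulation pos T ∧
  ∀ a b c, T.Adj a b → T.Adj b c → T.Adj a c →
    (∀ v, pos v ∈ convexHull ℝ {pos a, pos b, pos c} → v = a ∨ v = b ∨ v = c) →
    ∀ p : Plane, dist p (pos a) = dist p (pos b) → dist p (pos b) = dist p (pos c) →
      ∀ v, dist p (pos a) ≤ dist p (pos v)

/-- The unit Delaunay graph of a Delaunay triangulation `T`: the edges of length at most `1`. -/
def unitDelaunay {V : Type u} (pos : V → Plane) (T : SimpleGraph V) : SimpleGraph V :=
  T ⊓ unitDiskGraph pos

/-- `v` is a `k`-neighbor of `a`: at most `k` hops away in the unit disk graph. -/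
def IsKNeighbor {V : Type u} (pos : V → Plane) (k : ℕ) (a v : V) : Prop :=
  ∃ w : (unitDiskGraph pos).Walk a v, w.length ≤ k

/-- The triangle `abc` is `k`-localized Delaunay: its edges have length at most `1`, and the
interior of its circumcircle contains no `k`-neighbor of `a`, `b` or `c`. -/
def IsLocalizedTriangle {V : Type u} (pos : V → Plane) (k : ℕ) (a b c : V) : Prop :=
  (unitDiskGraph pos).Adj a b ∧ (unitDiskGraph pos).Adj b c ∧ (unitDiskGraph pos).Adj a c ∧
  ∃ p : Plane, dist p (pos a) = dist p (pos b) ∧ dist p (pos b) = dist p (pos c) ∧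
    ∀ v, IsKNeighbor pos k a v ∨ IsKNeighbor pos k b v ∨ IsKNeighbor pos k c v →
      dist p (pos a) ≤ dist p (pos v)

/-- The open disk with diameter `ab` contains no node. -/
def IsGabriel {V : Type u} (pos : V → Plane) (a b : V) : Prop :=
  ∀ v, dist (pos a) (pos b) / 2 ≤ dist (midpoint ℝ (pos a) (pos b)) (pos v)

/-- The `k`-localized Delaunay graph: all Gabriel edges of the unit disk graph and all edges of
`k`-localized Delaunay triangles. -/
def localizedDelaunay {V : Type u} (pos : V → Plane) (k : ℕ) : SimpleGraph V :=
  SimpleGraph.fromRel fun a b =>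
    (unitDiskGraph pos).Adj a b ∧ (IsGabriel pos a b ∨ ∃ c, IsLocalizedTriangle pos k a b c)

/-- No four nodes lie on a common circle. -/
def NoFourCocircular {V : Type u} (pos : V → Plane) : Prop :=
  ∀ (p : Plane) (r : ℝ), {v | dist p (pos v) = r}.encard ≤ 3

/-- The graphs the algorithm may start from: the unit Delaunay graph of a Delaunay triangulation,
or, when no four nodes are cocircular, a `k`-localized Delaunay graph with `k ≥ 2`. -/
def IsStartGraph {V : Type u} (pos : V → Plane) (D : SimpleGraph V) : Prop :=
  (∃ T, IsDelaunayTriangulation pos T ∧ D = unitDelaunay pos T) ∨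
  (NoFourCocircular pos ∧ ∃ k, 2 ≤ k ∧ D = localizedDelaunay pos k)

/-! ### The ordered Yao structure -/

/-- The unit vector at angle `θ`. -/
def dir (θ : ℝ) : Plane := !₂[Real.cos θ, Real.sin θ]

/-- `q` lies on the open ray from `p` at angle `θ`. -/
def OnRay (p : Plane) (θ : ℝ) (q : Plane) : Prop :=
  ∃ t : ℝ, 0 < t ∧ q = p + t • dir θ

/-- The open cone with apex `p` between the angles `θ₁` and `θ₂`. -/
def openCone (p : Plane) (θ₁ θ₂ : ℝ) : Set Plane :=
  {q | ∃ θ, θ₁ < θ ∧ θ < θ₂ ∧ OnRay p θ q}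

/-- The order of the nodes: node `v` is removed when exactly the nodes of rank at most
`ord v` remain, and it then has the smallest degree in the remaining graph, ties being broken by
smallest identifier. (The rank is counted from `0`; the node removed first has the largest.) -/
def IsYaoOrder {V : Type u} [Fintype V] (ID : V → ℕ) (F : SimpleGraph V)
    (ord : V ≃ Fin (Fintype.card V)) : Prop :=
  ∀ v w, ord w ≤ ord v →
    toLex ({x | F.Adj v x ∧ ord x ≤ ord v}.ncard, ID v) ≤
      toLex ({x | F.Adj w x ∧ ord x ≤ ord v}.ncard, ID w)

/-- The neighbors of `v` that are processed before `v`. -/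
def processedNeighbors {V : Type u} [Fintype V] (F : SimpleGraph V)
    (ord : V ≃ Fin (Fintype.card V)) (v : V) : Set V :=
  {x | F.Adj v x ∧ ord x < ord v}

/-- The cones shot at `v`: the rays through the nodes of `P` split the plane into sectors (a single
sector of angle `2π`, starting at an arbitrary ray, when `P` is empty), and each sector is
divided by rays into the fewest possible open cones of angle at most `π / 3`. -/
structure ConeDivision {V : Type u} (pos : V → Plane) (v : V) (P : Set V) where
  /-- the number of sectors -/
  numSectors : ℕ
  /-- sector `i` extends from the angle `ray i` to the angle `ray (i + 1)` -/
  ray : ℕ → ℝ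
  numSectors_pos : 0 < numSectors
  ray_lt : ∀ i < numSectors, ray i < ray (i + 1)
  ray_full : ray numSectors = ray 0 + 2 * Real.pi
  ray_mem : P.Nonempty → ∀ i < numSectors, ∃ x ∈ P, OnRay (pos v) (ray i) (pos x)
  ray_cover : ∀ x ∈ P, ∃ i < numSectors, OnRay (pos v) (ray i) (pos x)
  one_sector : P = ∅ → numSectors = 1
  /-- cone `j` of sector `i` extends from the angle `cut i j` to the angle `cut i (j + 1)` -/
  cut : ℕ → ℕ → ℝ
  cut_first : ∀ i < numSectors, cut i 0 = ray i
  cut_last : ∀ i < numSectors,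
    cut i ⌈(ray (i + 1) - ray i) / (Real.pi / 3)⌉₊ = ray (i + 1)
  cut_lt : ∀ i < numSectors, ∀ j < ⌈(ray (i + 1) - ray i) / (Real.pi / 3)⌉₊,
    cut i j < cut i (j + 1)
  cut_width : ∀ i < numSectors, ∀ j < ⌈(ray (i + 1) - ray i) / (Real.pi / 3)⌉₊,
    cut i (j + 1) - cut i j ≤ Real.pi / 3

/-- The cones of a division, each given by its two bounding angles. -/
def ConeDivision.IsCone {V : Type u} {pos : V → Plane} {v : V} {P : Set V}
    (K : ConeDivision pos v P) (θ : ℝ × ℝ) : Prop :=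
  ∃ i < K.numSectors, ∃ j < ⌈(K.ray (i + 1) - K.ray i) / (Real.pi / 3)⌉₊,
    θ = (K.cut i j, K.cut i (j + 1))

/-- The neighbors of `v` in the open cone at `v` between the angles `θ.1` and `θ.2`. -/
def coneNeighbors {V : Type u} (pos : V → Plane) (F : SimpleGraph V) (v : V) (θ : ℝ × ℝ) :
    Set V :=
  {x | F.Adj v x ∧ pos x ∈ openCone (pos v) θ.1 θ.2}

/-- `x` and `y` are consecutive, in this angular order, among the neighbors of `v` in the cone. -/
def IsConsecutive {V : Type u} (pos : V → Plane) (F : SimpleGraph V) (v : V) (θ : ℝ × ℝ)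
    (x y : V) : Prop :=
  F.Adj v x ∧ F.Adj v y ∧
  ∃ φ ψ, θ.1 < φ ∧ φ < ψ ∧ ψ < θ.2 ∧ OnRay (pos v) φ (pos x) ∧ OnRay (pos v) ψ (pos y) ∧
    ∀ z, F.Adj v z → ∀ χ, φ < χ → χ < ψ → ¬ OnRay (pos v) χ (pos z)

/-- `F'` is an output of the ordered Yao method on `F`. At every node `v`, every cone of a division
defined by the processed neighbors of `v` contributes one shortest edge from `v` to its
neighbors in the cone (`sel v θ`) and the edges joining consecutive neighbors in the cone. -/
def IsOrderedYao {V : Type u} [Fintype V] (pos : V → Plane) (ID : V → ℕ)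
    (F F' : SimpleGraph V) : Prop :=
  ∃ ord : V ≃ Fin (Fintype.card V), IsYaoOrder ID F ord ∧
  ∃ K : ∀ v, ConeDivision pos v (processedNeighbors F ord v),
  ∃ sel : V → ℝ × ℝ → V,
    (∀ v θ, (K v).IsCone θ → (coneNeighbors pos F v θ).Nonempty →
      sel v θ ∈ coneNeighbors pos F v θ ∧
      ∀ x ∈ coneNeighbors pos F v θ, dist (pos v) (pos (sel v θ)) ≤ dist (pos v) (pos x)) ∧
    F' = SimpleGraph.fromEdgeSet
      {e | ∃ v θ, (K v).IsCone θ ∧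
        (((coneNeighbors pos F v θ).Nonempty ∧ e = s(v, sel v θ)) ∨
          ∃ x y, IsConsecutive pos F v θ x y ∧ e = s(x, y))}

/-! ### Grid cells, cliques, shortest paths, clusters -/

/-- The closed `β × β` square with index `c` in the grid with origin `o`; its upper left corner is
`o + (β - 2δ) c`, so that the centers of adjacent cells are at distance `β - 2δ`. -/
def cell (o : Plane) (β δ : ℝ) (c : ℤ × ℤ) : Set Plane :=
  {x | o 0 + c.1 * (β - 2 * δ) ≤ x 0 ∧ x 0 ≤ o 0 + c.1 * (β - 2 * δ) + β ∧
       o 1 + c.2 * (β - 2 * δ) - β ≤ x 1 ∧ x 1 ≤ o 1 + c.2 * (β - 2 * δ)}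

/-- The element of the `(β, δ)`-clique cover given by the cell `c`. -/
def cellNodes {V : Type u} (pos : V → Plane) (o : Plane) (β δ : ℝ) (c : ℤ × ℤ) : Set V :=
  {v | pos v ∈ cell o β δ c}

/-- All edges of `D` incident to nodes of `S`, as a graph on all nodes. -/
def incidentGraph {V : Type u} (D : SimpleGraph V) (S : Set V) : SimpleGraph V where
  Adj a b := D.Adj a b ∧ (a ∈ S ∨ b ∈ S)
  symm := ⟨fun _ _ h => ⟨h.1.symm, h.2.symm⟩⟩
  loopless := ⟨fun a h => D.loopless.irrefl a h.1⟩

/-- The Euclidean length of a walk. -/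
def walkLength {V : Type u} (pos : V → Plane) {Q : SimpleGraph V} {a b : V} (w : Q.Walk a b) : ℝ :=
  (w.darts.map fun d => dist (pos d.fst) (pos d.snd)).sum

/-- The length of a shortest path from `a` to `b` in `Q` (`⊤` if there is none). -/
def spLength {V : Type u} (pos : V → Plane) (Q : SimpleGraph V) (a b : V) : ENNReal :=
  ⨅ w : Q.Walk a b, ENNReal.ofReal (walkLength pos w)

/-- The sets `N c`, for `c` in the set `centers`, form an `r`-cluster cover of the nodes in `Q`:
they are disjoint, `N c` is an `r`-cluster with center `c`, distinct centers are more than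
`r` apart in `Q`, and every node lies in some cluster. -/
def IsClusterCover {V : Type u} (pos : V → Plane) (Q : SimpleGraph V) (r : ℝ)
    (centers : Set V) (N : V → Set V) : Prop :=
  centers.PairwiseDisjoint N ∧
  (∀ c ∈ centers, ∀ v ∈ N c, spLength pos Q c v ≤ ENNReal.ofReal r) ∧
  (∀ c ∈ centers, ∀ c' ∈ centers, c ≠ c' → ENNReal.ofReal r < spLength pos Q c c') ∧
  (∀ v, ∃ c ∈ centers, v ∈ N c)

/-! ### The greedy step -/

/-- The identifier of a directed edge; identifiers are compared lexicographically. -/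
def arcID {V : Type u} (pos : V → Plane) (ID : V → ℕ) (a b : V) : ℝ ×ₗ ℕ ×ₗ ℕ :=
  toLex (dist (pos a) (pos b), toLex (ID a, ID b))

/-- The identifier of an undirected edge. -/
def edgeID {V : Type u} (pos : V → Plane) (ID : V → ℕ) : Sym2 V → ℝ ×ₗ ℕ ×ₗ ℕ :=
  Sym2.lift ⟨fun a b => min (arcID pos ID a b) (arcID pos ID b a), fun _ _ => min_comm _ _⟩

/-- The shortest path query: the endpoints of `e` have distance greater than `(1 + ε)` times the
length of `e` in the graph `Q`. -/
def QueryExceeds {V : Type u} (pos : V → Plane) (ε : ℝ) (Q : SimpleGraph V) (e : Sym2 V) : Prop :=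
  ∀ a b, e = s(a, b) → ENNReal.ofReal ((1 + ε) * dist (pos a) (pos b)) < spLength pos Q a b

/-- The variables of the greedy step: the current graph `YDel`, the graph `H` built so far, and
the query graph `Q` of the current cell. -/
structure GreedyState (V : Type u) where
  ydel : SimpleGraph V
  out : SimpleGraph V
  query : SimpleGraph V

open Classical in
/-- Processing one edge: add it to `H` and `Q`, or eliminate it from `YDel`. -/
def greedyEdge {V : Type u} (pos : V → Plane) (ε : ℝ) (S : GreedyState V) (e : Sym2 V) :
    GreedyState V :=
  if QueryExceeds pos ε S.query e then
    { ydel := S.ydel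
      out := S.out ⊔ SimpleGraph.fromEdgeSet {e}
      query := S.query ⊔ SimpleGraph.fromEdgeSet {e} }
  else
    { ydel := S.ydel.deleteEdges {e}
      out := S.out
      query := S.query }

/-- Processing one cell `N`, from `(YDel, H) = (Y, H)` to `(YDel, H) = (Y', H')`: the list `l` of
the edges of `Y` that lie in `N`, sorted by identifier, is processed edge by edge, the
query graph being initially `Y` without these edges. -/
def CellStep {V : Type u} (pos : V → Plane) (ID : V → ℕ) (ε : ℝ) (N : Set Plane)
    (Y H Y' H' : SimpleGraph V) : Prop :=
  ∃ l : List (Sym2 V),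
    l.Pairwise (fun e f => edgeID pos ID e < edgeID pos ID f) ∧
    (∀ e, e ∈ l ↔ e ∈ Y.edgeSet ∧ ∀ v ∈ e, pos v ∈ N) ∧
    Y' = (l.foldl (greedyEdge pos ε) ⟨Y, H, Y.deleteEdges {e | e ∈ l}⟩).ydel ∧
    H' = (l.foldl (greedyEdge pos ε) ⟨Y, H, Y.deleteEdges {e | e ∈ l}⟩).out

/-- Processing a list of cells one after the other. -/
def CellSteps {V : Type u} (pos : V → Plane) (ID : V → ℕ) (ε : ℝ) (N : ℤ × ℤ → Set Plane) :
    List (ℤ × ℤ) → SimpleGraph V → SimpleGraph V → SimpleGraph V → SimpleGraph V → Prop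
  | [], Y, H, Y', H' => Y' = Y ∧ H' = H
  | c :: cs, Y, H, Y', H' =>
      ∃ Y₁ H₁, CellStep pos ID ε (N c) Y H Y₁ H₁ ∧ CellSteps pos ID ε N cs Y₁ H₁ Y' H'

/-- The parity class (one of `0, 1, 2, 3`) of a cell. -/
def cellClass (c : ℤ × ℤ) : ℤ := (c.1 % 2) * 2 + c.2 % 2

/-- A list of cells as visited by the greedy step: the four parity classes are visited one class
after the other (class `k` in round `round k`), the cells of a class in any order. Only the cells
that contain a node matter, since nothing happens in the others. -/
def IsCellSchedule {V : Type u} (pos : V → Plane) (N : ℤ × ℤ → Set Plane)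
    (cs : List (ℤ × ℤ)) : Prop :=
  cs.Nodup ∧ (∀ c, c ∈ cs ↔ ∃ v, pos v ∈ N c) ∧
  ∃ round : ℤ → ℤ, Function.Injective round ∧
    cs.Pairwise fun c c' => round (cellClass c) ≤ round (cellClass c')

/-! ### The algorithm -/

/-- `H` is an output of the algorithm on the unit disk graph of `pos` with parameter `ε`, run with
the constants `β`, `δ` and the grid origin `o`, and `Y c` is the graph `YDel` of the
clique given by the cell `c` (the edgeless graph if the cell contains no node). -/
def IsRun {V : Type u} [Fintype V] (pos : V → Plane) (ID : V → ℕ) (ε β δ : ℝ) (o : Plane)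
    (Y : ℤ × ℤ → SimpleGraph V) (H : SimpleGraph V) : Prop :=
  -- Step 1: the start graph
  ∃ D : SimpleGraph V, IsStartGraph pos D ∧
  -- Step 2: the ordered Yao structure of the edges incident to each clique
  (∀ c, IsOrderedYao pos ID (incidentGraph D (cellNodes pos o β δ c)) (Y c)) ∧
  -- Step 3: greedy in the grid cells, starting from the union of the graphs `Y c`
  ∃ (cs : List (ℤ × ℤ)) (Y₃ H₃ : SimpleGraph V),
    IsCellSchedule pos (cell o β δ) cs ∧
    CellSteps pos ID ε (cell o β δ) cs (⨆ c, Y c) ⊥ Y₃ H₃ ∧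
  -- Step 4: add the remaining edges that connect cluster centers
  ∃ (r : ℝ) (centers : Set V) (N : V → Set V),
    0 ≤ r ∧ r ≤ ε * δ / 4 ∧ IsClusterCover pos Y₃ r centers N ∧
    H = H₃ ⊔ SimpleGraph.fromEdgeSet
      {e | e ∈ Y₃.edgeSet ∧ ∀ v ∈ e, v ∈ centers}

end

end PLOS

namespace PLOS

/-! ### Plane graphs have a node of degree at most five -/

/-! Every start graph is drawn without crossings: a Delaunay triangulation by definition, and a
localized Delaunay graph because two crossing edges would put four nodes on one circle
(`localizedDelaunay.isNoncrossing`). A noncrossing straight-line graph on n nodes has fewer than 3n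
edges, hence a node of degree at most 5. So in the removal order of OrderedYao at most five
neighbors of a node are processed before it (`IsYaoOrder.ncard_processedNeighbors_le`).

The edges at v in one Yao output are of two kinds. Those selected in cones at v number at most 10,
since at most five rays cut out fewer than 6 + 5 cones. Any other comes from a cone at a neighbor u
that contains v. The cones are open, so v defines no ray at u; hence u was processed before v, and
there are at most five such u. Each gives at most the edge uv and the edges from v to the two
angular neighbors of v around u. The total is 10 + 3 · 5 = 25 (`IsOrderedYao.ncard_neighborSet_le`).

A node with an edge in the Yao graph of a cell lies in that cell or has a neighbor there, so the
cell comes within distance 1 of it. As the grid step exceeds β/2, at most 49/β² cells do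
(`exists_cells_near`). The greedy and cluster steps create no edges (`IsRun.le_iSup`), so the degree
in the output is at most 25 times the number of these cells. -/

/-- The slope of the segment from `a` to `b` in the coordinates `X`, `Y`. -/
noncomputable def edgeSlope {V : Type*} (X Y : V → ℝ) (a b : V) : ℝ := (Y b - Y a) / (X b - X a)

/-- The height at abscissa `x` of the line through `a` and `b`. -/
noncomputable def edgeHeight {V : Type*} (X Y : V → ℝ) (a b : V) (x : ℝ) : ℝ :=
  Y a + edgeSlope X Y a b * (x - X a)

/-- A graph drawn with straight segments in the coordinates `X`, `Y` (the abscissas being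
distinct) has no node in the interior of an edge and no two edges sharing an interior point. -/
structure HeightPlane {V : Type*} (X Y : V → ℝ) (G : SimpleGraph V) : Prop where
  inj : Function.Injective X
  node : ∀ a b v, G.Adj a b → X a < X v → X v < X b → Y v ≠ edgeHeight X Y a b (X v)
  cross : ∀ a b c d, G.Adj a b → G.Adj c d → (a, b) ≠ (c, d) → ∀ x, X a < x → x < X b →
    X c < x → x < X d → edgeHeight X Y a b x ≠ edgeHeight X Y c d x

/-! ### Fewer than three edges per node, by a left-to-right sweep. -/

section Height

variable {V : Type*} {X Y : V → ℝ} {G : SimpleGraph V}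

lemma edgeHeight_left (a b : V) : edgeHeight X Y a b (X a) = Y a := by
  simp [edgeHeight]

lemma edgeHeight_right {a b : V} (h : X a < X b) : edgeHeight X Y a b (X b) = Y b := by
  have : X b - X a ≠ 0 := by linarith
  unfold edgeHeight edgeSlope
  field_simp
  ring

lemma edgeHeight_lt {a b c : V} {x : ℝ} (hx : X a < x)
    (h : edgeSlope X Y a b < edgeSlope X Y a c) :
    edgeHeight X Y a b x < edgeHeight X Y a c x := by
  unfold edgeHeight
  have := mul_lt_mul_of_pos_right h (sub_pos.2 hx)
  linarith

lemma edgeSlope_lt {a b c : V} {x : ℝ} (hx : X a < x)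
    (h : edgeHeight X Y a b x < edgeHeight X Y a c x) :
    edgeSlope X Y a b < edgeSlope X Y a c := by
  unfold edgeHeight at h
  exact lt_of_mul_lt_mul_right (by linarith) (sub_pos.2 hx).le

/-- Two edges keep their vertical order over their common range. -/
lemma HeightPlane.height_le (hG : HeightPlane X Y G) {a b c d : V} (hab : G.Adj a b)
    (hcd : G.Adj c d) {x₀ x₁ : ℝ} (h0 : edgeHeight X Y a b x₀ < edgeHeight X Y c d x₀)
    (ha0 : X a ≤ x₀) (hb0 : x₀ ≤ X b) (hc0 : X c ≤ x₀) (hd0 : x₀ ≤ X d)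
    (ha1 : X a ≤ x₁) (hb1 : x₁ ≤ X b) (hc1 : X c ≤ x₁) (hd1 : x₁ ≤ X d) :
    edgeHeight X Y a b x₁ ≤ edgeHeight X Y c d x₁ := by
  by_contra! h1
  have hne : (a, b) ≠ (c, d) := by
    rintro h
    obtain ⟨rfl, rfl⟩ := Prod.mk.inj h
    exact lt_irrefl _ h0
  have hx : x₀ ≠ x₁ := by rintro rfl; exact lt_asymm h0 h1
  set p := edgeHeight X Y c d x₀ - edgeHeight X Y a b x₀ with hp
  set q := edgeHeight X Y a b x₁ - edgeHeight X Y c d x₁ with hq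
  have hp0 : 0 < p := sub_pos.2 h0
  have hq0 : 0 < q := sub_pos.2 h1
  -- With this weight the height difference, which is affine in the abscissa, vanishes at t x₀ + (1
  -- - t) x₁. That abscissa is interior to both edges because x₀ ≠ x₁.
  obtain ⟨t, ht⟩ : ∃ t, t = q / (p + q) := ⟨_, rfl⟩
  have ht0 : 0 < t := by rw [ht]; positivity
  have ht1 : 0 < 1 - t := by
    have : 1 - t = p / (p + q) := by rw [ht]; field_simp; ring
    rw [this]; positivity
  have htpq : t * p = (1 - t) * q := by rw [ht]; field_simp; ring
  have low : ∀ L, L ≤ x₀ → L ≤ x₁ → L < t * x₀ + (1 - t) * x₁ := by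
    intro L h₀ h₁
    rcases lt_or_gt_of_ne hx with h | h
    · nlinarith [mul_nonneg ht0.le (sub_nonneg.2 h₀), mul_pos ht1 (sub_pos.2 (h₀.trans_lt h))]
    · nlinarith [mul_pos ht0 (sub_pos.2 (h₁.trans_lt h)), mul_nonneg ht1.le (sub_nonneg.2 h₁)]
  have high : ∀ R, x₀ ≤ R → x₁ ≤ R → t * x₀ + (1 - t) * x₁ < R := by
    intro R h₀ h₁
    rcases lt_or_gt_of_ne hx with h | h
    · nlinarith [mul_pos ht0 (sub_pos.2 (h.trans_le h₁)), mul_nonneg ht1.le (sub_nonneg.2 h₁)]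
    · nlinarith [mul_nonneg ht0.le (sub_nonneg.2 h₀), mul_pos ht1 (sub_pos.2 (h.trans_le h₀))]
  refine hG.cross a b c d hab hcd hne _ (low _ ha0 ha1) (high _ hb0 hb1) (low _ hc0 hc1)
    (high _ hd0 hd1) ?_
  have aff : ∀ u v : V, edgeHeight X Y u v (t * x₀ + (1 - t) * x₁) =
      t * edgeHeight X Y u v x₀ + (1 - t) * edgeHeight X Y u v x₁ := by
    intro u v; unfold edgeHeight; ring
  rw [aff, aff]
  linear_combination (-1 : ℝ) * htpq

lemma HeightPlane.slope_injective (hG : HeightPlane X Y G) {a b c : V} (hab : G.Adj a b)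
    (hac : G.Adj a c) (hb : X a < X b) (hc : X a < X c)
    (h : edgeSlope X Y a b = edgeSlope X Y a c) : b = c := by
  by_contra hne
  obtain ⟨x, hx, hx'⟩ := exists_between (lt_min hb hc)
  rw [lt_min_iff] at hx'
  refine hG.cross a b a c hab hac (fun h => hne (Prod.mk.inj h).2) x hx hx'.1 hx hx'.2 ?_
  simp [edgeHeight, h]

lemma HeightPlane.eq_of_height_eq (hG : HeightPlane X Y G) {a b w : V} (hab : G.Adj a b)
    (haw : X a < X w) (hwb : X w ≤ X b) (h : edgeHeight X Y a b (X w) = Y w) : w = b := by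
  rcases hwb.lt_or_eq with hlt | heq
  · exact absurd h.symm (hG.node a b w hab haw hlt)
  · exact hG.inj heq

/-- The trapezoid that opens to the right at `u` between the consecutive edges `ub` (below) and `ua`
(above) and ends at the node `w`. -/
structure IsTrapezoid (X Y : V → ℝ) (G : SimpleGraph V) (u a b w : V) : Prop where
  adj : G.Adj u b
  slope : edgeSlope X Y u b < edgeSlope X Y u a
  left : X u < X w
  right_above : X w ≤ X a
  right_below : X w ≤ X b
  below : edgeHeight X Y u b (X w) ≤ Y w
  above : Y w ≤ edgeHeight X Y u a (X w)
  empty : ∀ c d, G.Adj c d → ∀ x, X u < x → x < X w → X c < x → x < X d →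
    edgeHeight X Y u b x < edgeHeight X Y c d x → edgeHeight X Y u a x ≤ edgeHeight X Y c d x

/-- Take for `b` the steepest edge at `u` below `ua`, and for `w` the leftmost node in the closed
wedge between the two edges, to the right of `u` and no further than either edge reaches. -/
lemma HeightPlane.exists_trapezoid [Finite V] (hG : HeightPlane X Y G) {u a : V}
    (hua : G.Adj u a) (hX : X u < X a)
    (hlow : ∃ b, G.Adj u b ∧ X u < X b ∧ edgeSlope X Y u b < edgeSlope X Y u a) :
    ∃ b w, IsTrapezoid X Y G u a b w := by
  obtain ⟨b, ⟨hub, hXb, hsl⟩, hmax⟩ := Set.exists_max_image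
    {b | G.Adj u b ∧ X u < X b ∧ edgeSlope X Y u b < edgeSlope X Y u a} (edgeSlope X Y u)
    (Set.toFinite _) hlow
  have hne : {w | X u < X w ∧ X w ≤ X a ∧ X w ≤ X b ∧ edgeHeight X Y u b (X w) ≤ Y w ∧
      Y w ≤ edgeHeight X Y u a (X w)}.Nonempty := by
    rcases le_total (X a) (X b) with h | h
    · refine ⟨a, hX, le_rfl, h, ?_, (edgeHeight_right hX).ge⟩
      rw [← edgeHeight_right (Y := Y) hX]
      exact (edgeHeight_lt hX hsl).le
    · refine ⟨b, hXb, h, le_rfl, (edgeHeight_right hXb).le, ?_⟩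
      rw [← edgeHeight_right (Y := Y) hXb]
      exact (edgeHeight_lt hXb hsl).le
  obtain ⟨w, ⟨hw1, hw2, hw3, hw4, hw5⟩, hmin⟩ := Set.exists_min_image _ X (Set.toFinite _) hne
  refine ⟨b, w, hub, hsl, hw1, hw2, hw3, hw4, hw5, ?_⟩
  intro c d hcd x hux hxw hcx hxd hb
  by_contra! ha
  have hxa := hxw.le.trans hw2
  have hxb := hxw.le.trans hw3
  -- An edge strictly inside the wedge before `w` is excluded by the place of its left end: left of
  -- `u` it would pass through `u`, at `u` it would contradict the choice of `b`, and right of `u`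
  -- its left end would be a candidate for `w` further left.
  rcases lt_trichotomy (X c) (X u) with h | h | h
  · have h1 := hG.height_le hub hcd hb hux.le hxb hcx.le hxd.le le_rfl hXb.le h.le
      (hux.trans hxd).le
    have h2 := hG.height_le hcd hua ha hcx.le hxd.le hux.le hxa h.le
      (hux.trans hxd).le le_rfl hX.le
    rw [edgeHeight_left] at h1 h2
    exact hG.node c d u hcd h (hux.trans hxd) (le_antisymm h1 h2)
  · obtain rfl := hG.inj h
    have := hmax d ⟨hcd, hux.trans hxd, edgeSlope_lt hux ha⟩
    exact absurd (edgeSlope_lt hux hb) this.not_gt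
  · have h1 := hG.height_le hub hcd hb hux.le hxb hcx.le hxd.le h.le (hcx.le.trans hxb) le_rfl
      (hcx.trans hxd).le
    have h2 := hG.height_le hcd hua ha hcx.le hxd.le hux.le hxa le_rfl (hcx.trans hxd).le h.le
      (hcx.le.trans hxa)
    rw [edgeHeight_left] at h1 h2
    have := hmin c ⟨h, hcx.le.trans hxa, hcx.le.trans hxb, h1, h2⟩
    linarith

/-- Two trapezoids with the same right end, one of them having the higher upper edge. -/
lemma IsTrapezoid.end_eq (hG : HeightPlane X Y G) {u a b u' a' b' w : V} (hua : G.Adj u a)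
    (h : IsTrapezoid X Y G u a b w) (h' : IsTrapezoid X Y G u' a' b' w) {x : ℝ} (hx : X u < x)
    (hx' : X u' < x) (hxw : x < X w) (hlt : edgeHeight X Y u a x < edgeHeight X Y u' a' x) :
    w = a ∧ w = b' := by
  -- The second trapezoid is empty, so the lower ceiling cannot exceed its floor; at `w` that
  -- ceiling and that floor are then squeezed together.
  have h1 : edgeHeight X Y u a x ≤ edgeHeight X Y u' b' x := by
    by_contra! hc
    exact (h'.empty u a hua x hx' hxw hx (hxw.trans_le h.right_above) hc).not_gt hlt
  have h2 : edgeHeight X Y u a (X w) ≤ edgeHeight X Y u' b' (X w) := by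
    by_cases he : (u, a) = (u', b')
    · obtain ⟨rfl, rfl⟩ := Prod.mk.inj he
      exact le_rfl
    · have hne := hG.cross u a u' b' hua h'.adj he x hx (hxw.trans_le h.right_above) hx'
        (hxw.trans_le h'.right_below)
      exact hG.height_le hua h'.adj (lt_of_le_of_ne h1 hne) hx.le (hxw.le.trans h.right_above)
        hx'.le (hxw.le.trans h'.right_below) h.left.le h.right_above h'.left.le h'.right_below
  have h3 := h.above
  have h4 := h'.below
  exact ⟨hG.eq_of_height_eq hua h.left h.right_above (by linarith),
    hG.eq_of_height_eq h'.adj h'.left h'.right_below (by linarith)⟩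

/-- Of two different upper edges just left of `w`, the lower one ends at `w`, as does the floor of
the other trapezoid. If the other upper edge also ended at `w`, it would coincide with its own
floor. So `w`, together with the bit telling whether the upper edge ends there, determines that
edge. -/
lemma IsTrapezoid.edge_unique (hG : HeightPlane X Y G) {u a b u' a' b' w : V} (hua : G.Adj u a)
    (hua' : G.Adj u' a') (h : IsTrapezoid X Y G u a b w) (h' : IsTrapezoid X Y G u' a' b' w)
    (hw : w = a ↔ w = a') : (u, a) = (u', a') := by
  by_contra hne
  obtain ⟨x, hx, hxw⟩ := exists_between (max_lt h.left h'.left)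
  rw [max_lt_iff] at hx
  rcases lt_or_gt_of_ne (hG.cross u a u' a' hua hua' hne x hx.1 (hxw.trans_le h.right_above) hx.2
    (hxw.trans_le h'.right_above)) with hlt | hlt
  · obtain ⟨h1, h2⟩ := h.end_eq hG hua h' hx.1 hx.2 hxw hlt
    have h3 := hw.1 h1
    have := h'.slope
    rw [← h2, ← h3] at this
    exact lt_irrefl _ this
  · obtain ⟨h1, h2⟩ := h'.end_eq hG hua' h hx.2 hx.1 hxw hlt
    have h3 := hw.2 h1
    have := h.slope
    rw [← h2, ← h3] at this
    exact lt_irrefl _ this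

open Classical in
-- Edges are counted at their left ends. The lowest edges number at most one per node and none at
-- the rightmost node; each other edge is the ceiling of a trapezoid, and each node ends at most two
-- of those in the chosen assignment.
lemma HeightPlane.card_edges_lt [Fintype V] [Nonempty V] (hG : HeightPlane X Y G) :
    (Finset.univ.filter fun e : V × V => G.Adj e.1 e.2 ∧ X e.1 < X e.2).card <
      3 * Fintype.card V := by
  set E := Finset.univ.filter fun e : V × V => G.Adj e.1 e.2 ∧ X e.1 < X e.2 with hE
  set P : V × V → Prop := fun e =>
    ∃ b, G.Adj e.1 b ∧ X e.1 < X b ∧ edgeSlope X Y e.1 b < edgeSlope X Y e.1 e.2 with hP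
  have h1 : (E.filter fun e => ¬ P e).card < Fintype.card V := by
    obtain ⟨m, -, hm⟩ := Finset.exists_max_image (Finset.univ : Finset V) X Finset.univ_nonempty
    refine (Finset.card_le_card_of_injOn (t := Finset.univ.erase m) Prod.fst ?_ ?_).trans_lt ?_
    · rintro ⟨u, a⟩ he
      simp only [hE, Finset.coe_filter, Finset.mem_filter, Finset.mem_univ, true_and,
        Set.mem_ofPred_eq] at he
      simp only [Finset.coe_erase, Finset.coe_univ, Set.mem_sdiff, Set.mem_univ, true_and,
        Set.mem_singleton_iff]
      rintro rfl
      exact (hm a (Finset.mem_univ _)).not_gt he.1.2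
    · rintro ⟨u, a⟩ he ⟨u', a'⟩ he' (rfl : u = u')
      simp only [hE, hP, Finset.coe_filter, Finset.mem_filter, Finset.mem_univ, true_and,
        Set.mem_ofPred_eq, not_exists, not_and, not_lt] at he he'
      rw [hG.slope_injective he.1.1 he'.1.1 he.1.2 he'.1.2
        (le_antisymm (he.2 a' he'.1.1 he'.1.2) (he'.2 a he.1.1 he.1.2))]
    · rw [Finset.card_erase_of_mem (Finset.mem_univ _), Finset.card_univ]
      exact Nat.sub_lt Fintype.card_pos one_pos
  have h2 : (E.filter P).card ≤ 2 * Fintype.card V := by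
    have key : ∀ e : V × V, ∃ w, e ∈ E.filter P → ∃ b, IsTrapezoid X Y G e.1 e.2 b w := by
      intro e
      by_cases he : e ∈ E.filter P
      · have he' := he
        simp only [hE, Finset.mem_filter, Finset.mem_univ, true_and] at he'
        obtain ⟨b, w, h⟩ := hG.exists_trapezoid he'.1.1 he'.1.2 he'.2
        exact ⟨w, fun _ => ⟨b, h⟩⟩
      · exact ⟨e.1, fun h => absurd h he⟩
    choose f hf using key
    have : (E.filter P).card ≤ (Finset.univ : Finset (V × Bool)).card := by
      refine Finset.card_le_card_of_injOn (fun e => (f e, decide (f e = e.2)))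
        (fun _ _ => Finset.mem_coe.2 (Finset.mem_univ _)) ?_
      rintro ⟨u, a⟩ he ⟨u', a'⟩ he' heq
      simp only [Prod.mk.injEq, decide_eq_decide] at heq
      obtain ⟨hw, hiff⟩ := heq
      obtain ⟨b, h⟩ := hf _ he
      obtain ⟨b', h'⟩ := hf _ he'
      simp only [hE, Finset.coe_filter, Finset.mem_filter, Finset.mem_univ, true_and,
        Set.mem_ofPred_eq] at he he'
      rw [← hw] at h' hiff
      exact h.edge_unique hG he.1.1 he'.1.1 h' hiff
    simpa [Fintype.card_prod, mul_comm] using this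
  have := Finset.card_filter_add_card_filter_not (s := E) P
  omega

open Classical in
lemma HeightPlane.exists_degree_le_five [Fintype V] [Nonempty V] (hG : HeightPlane X Y G) :
    ∃ v, (G.neighborSet v).ncard ≤ 5 := by
  by_contra! hc
  have hlt := hG.card_edges_lt
  set E := Finset.univ.filter fun e : V × V => G.Adj e.1 e.2 ∧ X e.1 < X e.2 with hE
  set D := Finset.univ.filter fun e : V × V => G.Adj e.1 e.2 with hD
  have h1 : D ⊆ E ∪ E.image Prod.swap := by
    rintro ⟨a, b⟩ h
    simp only [hD, Finset.mem_filter, Finset.mem_univ, true_and] at h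
    simp only [hE, Finset.mem_union, Finset.mem_filter, Finset.mem_univ, true_and,
      Finset.mem_image, Prod.exists, Prod.swap_prod_mk, Prod.mk.injEq]
    rcases lt_or_gt_of_ne (hG.inj.ne h.ne) with hl | hl
    · exact .inl ⟨h, hl⟩
    · exact .inr ⟨b, a, ⟨h.symm, hl⟩, rfl, rfl⟩
  have h2 : D.card ≤ 2 * E.card := by
    refine (Finset.card_le_card h1).trans ((Finset.card_union_le _ _).trans ?_)
    have := Finset.card_image_le (s := E) (f := Prod.swap)
    omega
  have h3 : 6 * Fintype.card V ≤ D.card := by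
    have : D.card = ∑ v, (D.filter fun e => e.1 = v).card :=
      Finset.card_eq_sum_card_fiberwise fun _ _ => Finset.mem_coe.2 (Finset.mem_univ _)
    rw [this, mul_comm, ← Finset.card_univ, ← smul_eq_mul]
    refine Finset.card_nsmul_le_sum _ _ _ fun v _ => ?_
    refine le_trans (Nat.succ_le_of_lt (hc v)) ?_
    rw [← Set.ncard_coe_finset]
    refine Set.ncard_le_ncard_of_injOn (fun w => (v, w)) ?_ ?_ (Finset.finite_toSet _)
    · intro w hw
      simpa [hD] using hw
    · intro w _ w' _ h
      exact (Prod.mk.inj h).2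
  omega

end Height

/-! ### From noncrossing drawings to distinct abscissas. -/

/-- A graph drawn with straight segments has no node in the interior of an edge and no two edges
sharing an interior point. -/
structure IsNoncrossing {V : Type*} (pos : V → Plane) (G : SimpleGraph V) : Prop where
  node : ∀ a b v, G.Adj a b → pos v ∈ segment ℝ (pos a) (pos b) → v = a ∨ v = b
  cross : ∀ a b c d, G.Adj a b → G.Adj c d → s(a, b) ≠ s(c, d) →
    ∀ x ∈ openSegment ℝ (pos a) (pos b), x ∉ openSegment ℝ (pos c) (pos d)

/-- A sheared coordinate takes distinct values at finitely many distinct points. -/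
lemma exists_injective_shear {V : Type*} [Finite V] {pos : V → Plane}
    (hpos : Function.Injective pos) :
    ∃ η : ℝ, Function.Injective fun v => pos v 0 + η * pos v 1 := by
  -- Finitely many shears make two abscissas agree. Pairs with equal ordinates contribute the
  -- quotient by zero, which is 0 and only excludes one more value.
  obtain ⟨η, hη⟩ := (Set.toFinite (Set.range fun e : V × V =>
    -(pos e.1 0 - pos e.2 0) / (pos e.1 1 - pos e.2 1))).infinite_compl.nonempty
  refine ⟨η, fun v w h => hpos ?_⟩
  have h' : pos v 0 + η * pos v 1 = pos w 0 + η * pos w 1 := h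
  by_cases h1 : pos v 1 = pos w 1
  · ext i
    fin_cases i
    · simpa [h1] using h'
    · exact h1
  · refine absurd ⟨(v, w), ?_⟩ hη
    have : pos v 1 - pos w 1 ≠ 0 := sub_ne_zero.2 h1
    simp only
    field_simp
    linarith

/-- The shear (x, y) ↦ (x + ηy, y) is linear and invertible, so incidences seen in the sheared
coordinates hold in the plane. -/
lemma mem_openSegment_of_height {a b P : Plane} {η : ℝ} (hab : a 0 + η * a 1 < b 0 + η * b 1)
    (hl : a 0 + η * a 1 < P 0 + η * P 1) (hr : P 0 + η * P 1 < b 0 + η * b 1)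
    (hP : P 1 = a 1 + (b 1 - a 1) / ((b 0 + η * b 1) - (a 0 + η * a 1)) *
      ((P 0 + η * P 1) - (a 0 + η * a 1))) :
    P ∈ openSegment ℝ a b := by
  have hd : 0 < (b 0 + η * b 1) - (a 0 + η * a 1) := sub_pos.2 hab
  obtain ⟨t, ht⟩ : ∃ t, t = ((P 0 + η * P 1) - (a 0 + η * a 1)) /
    ((b 0 + η * b 1) - (a 0 + η * a 1)) := ⟨_, rfl⟩
  have ht0 : 0 < t := by rw [ht]; exact div_pos (sub_pos.2 hl) hd
  have ht1 : t < 1 := by rw [ht, div_lt_one hd]; linarith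
  have hx : (P 0 + η * P 1) - (a 0 + η * a 1) = t * ((b 0 + η * b 1) - (a 0 + η * a 1)) := by
    rw [ht]; field_simp
  have hy : P 1 = a 1 + t * (b 1 - a 1) := by
    rw [hP, ht]; ring
  refine ⟨1 - t, t, by linarith, ht0, by ring, ?_⟩
  ext i
  fin_cases i
  · simp
    rw [hy] at hx
    linear_combination -hx
  · simp
    rw [hy]; ring

/-- Shearing the coordinates turns a noncrossing drawing into one with distinct abscissas. -/
lemma IsNoncrossing.exists_heightPlane {V : Type*} [Finite V] {pos : V → Plane}
    (hpos : Function.Injective pos) {G : SimpleGraph V} (hG : IsNoncrossing pos G) :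
    ∃ X Y : V → ℝ, HeightPlane X Y G := by
  obtain ⟨η, hη⟩ := exists_injective_shear hpos
  refine ⟨fun v => pos v 0 + η * pos v 1, fun v => pos v 1, hη, ?_, ?_⟩
  · intro a b v hab hl hr h
    rcases hG.node a b v hab (openSegment_subset_segment _ _ _
      (mem_openSegment_of_height (hl.trans hr) hl hr h)) with rfl | rfl
    · exact lt_irrefl _ hl
    · exact lt_irrefl _ hr
  · intro a b c d hab hcd hne x hax hxb hcx hxd h
    have hne' : s(a, b) ≠ s(c, d) := by
      rw [Ne, Sym2.eq_iff]
      rintro (⟨rfl, rfl⟩ | ⟨rfl, rfl⟩)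
      · exact hne rfl
      · exact lt_irrefl _ ((hax.trans hxb).trans (hcx.trans hxd))
    obtain ⟨y, hy⟩ : ∃ y, y = edgeHeight (fun v => pos v 0 + η * pos v 1) (fun v => pos v 1) a b x :=
      ⟨_, rfl⟩
    have hP : (!₂[x - η * y, y] : Plane) 0 + η * (!₂[x - η * y, y] : Plane) 1 = x := by simp
    refine hG.cross a b c d hab hcd hne' !₂[x - η * y, y] ?_ ?_
    · apply mem_openSegment_of_height (η := η) (hax.trans hxb) <;> rw [hP]
      · exact hax
      · exact hxb
      · exact hy
    · apply mem_openSegment_of_height (η := η) (hcx.trans hxd) <;> rw [hP]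
      · exact hcx
      · exact hxd
      · exact hy.trans h

theorem IsNoncrossing.exists_degree_le_five {V : Type*} [Fintype V] [Nonempty V] {pos : V → Plane}
    (hpos : Function.Injective pos) {G : SimpleGraph V} (hG : IsNoncrossing pos G) :
    ∃ v, (G.neighborSet v).ncard ≤ 5 := by
  obtain ⟨X, Y, h⟩ := hG.exists_heightPlane hpos
  exact h.exists_degree_le_five

/-! ### The start graph is plane -/

lemma IsNoncrossing.mono {V : Type*} {pos : V → Plane} {G G' : SimpleGraph V} (h : G' ≤ G)
    (hG : IsNoncrossing pos G) : IsNoncrossing pos G' where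
  node a b v hab := hG.node a b v (h hab)
  cross a b c d hab hcd := hG.cross a b c d (h hab) (h hcd)

lemma IsPlane.isNoncrossing {V : Type*} {pos : V → Plane} (hpos : Function.Injective pos)
    {G : SimpleGraph V} (hG : IsPlane pos G) : IsNoncrossing pos G where
  node := hG.1
  cross a b c d hab hcd hne x hx hx' := by
    obtain ⟨v, hv, -, rfl⟩ := hG.2 a b c d hab hcd hne x
      ⟨openSegment_subset_segment _ _ _ hx, openSegment_subset_segment _ _ _ hx'⟩
    rcases Sym2.mem_iff.1 hv with rfl | rfl
    · exact hab.ne (hpos (left_mem_openSegment_iff.1 hx))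
    · exact hab.ne (hpos (right_mem_openSegment_iff.1 hx))

/-- The edges of a localized Delaunay graph are chords of circles that contain no node near their
endpoints. -/
lemma localizedDelaunay.exists_circle {V : Type*} {pos : V → Plane} {k : ℕ} {a b : V}
    (h : (localizedDelaunay pos k).Adj a b) :
    (unitDiskGraph pos).Adj a b ∧ ∃ p : Plane, dist p (pos a) = dist p (pos b) ∧
      ∀ v, IsKNeighbor pos k a v ∨ IsKNeighbor pos k b v → dist p (pos a) ≤ dist p (pos v) := by
  have gab : ∀ a b : V, IsGabriel pos a b → ∃ p : Plane, dist p (pos a) = dist p (pos b) ∧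
      ∀ v, dist p (pos a) ≤ dist p (pos v) := by
    intro a b h
    refine ⟨midpoint ℝ (pos a) (pos b), by rw [dist_midpoint_left, dist_midpoint_right], fun v => ?_⟩
    have := h v
    rw [dist_midpoint_left, Real.norm_eq_abs, abs_of_pos (by norm_num : (0 : ℝ) < 2)]
    linarith
  rw [localizedDelaunay, SimpleGraph.fromRel_adj] at h
  obtain ⟨-, ⟨hu, hg | ⟨c, -, -, -, p, h1, h2, h3⟩⟩ | ⟨hu, hg | ⟨c, -, -, -, p, h1, h2, h3⟩⟩⟩ := h
  · obtain ⟨p, h1, h2⟩ := gab a b hg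
    exact ⟨hu, p, h1, fun v _ => h2 v⟩
  · exact ⟨hu, p, h1, fun v hv => h3 v (hv.imp_right .inl)⟩
  · obtain ⟨p, h1, h2⟩ := gab b a hg
    exact ⟨hu.symm, p, h1.symm, fun v _ => h1 ▸ h2 v⟩
  · exact ⟨hu.symm, p, h1.symm, fun v hv => h1 ▸ h3 v (hv.symm.imp_right .inl)⟩

lemma isKNeighbor_of_adj {V : Type*} {pos : V → Plane} {k : ℕ} (hk : 1 ≤ k) {a v : V}
    (h : (unitDiskGraph pos).Adj a v) : IsKNeighbor pos k a v :=
  ⟨h.toWalk, by simpa using hk⟩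

/-- Two hops suffice: from `a` to `c`, then along the edge `cd`. -/
lemma isKNeighbor_of_dist_le {V : Type*} {pos : V → Plane} {k : ℕ} (hk : 2 ≤ k) {a c d : V}
    (h : dist (pos a) (pos c) ≤ 1) (hcd : (unitDiskGraph pos).Adj c d) :
    IsKNeighbor pos k a c ∧ IsKNeighbor pos k a d := by
  by_cases hac : a = c
  · subst hac
    exact ⟨⟨.nil, by simp⟩, isKNeighbor_of_adj (by omega) hcd⟩
  · have hadj : (unitDiskGraph pos).Adj a c := ⟨hac, h⟩
    exact ⟨isKNeighbor_of_adj (by omega) hadj, .cons hadj hcd.toWalk, by simpa using hk⟩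

/-- The endpoints of an edge are near an endpoint of any edge that it meets. -/
lemma isKNeighbor_of_mem_segment {V : Type*} {pos : V → Plane} {k : ℕ} (hk : 2 ≤ k) {a b c d : V}
    (hab : (unitDiskGraph pos).Adj a b) (hcd : (unitDiskGraph pos).Adj c d) {x : Plane}
    (hx : x ∈ segment ℝ (pos a) (pos b)) (hx' : x ∈ segment ℝ (pos c) (pos d)) :
    (IsKNeighbor pos k a c ∨ IsKNeighbor pos k b c) ∧
      (IsKNeighbor pos k a d ∨ IsKNeighbor pos k b d) := by
  have h1 := dist_add_dist_of_mem_segment hx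
  have h2 := dist_add_dist_of_mem_segment hx'
  have h3 := dist_triangle (pos a) x (pos c)
  have h4 := dist_triangle (pos b) x (pos d)
  rw [dist_comm x (pos c)] at h3
  rw [dist_comm (pos b) x] at h4
  have h5 := hab.2
  have h6 := hcd.2
  -- The triangle inequalities through the common point give |ac| + |bd| ≤ |ab| + |cd| ≤ 2, so one
  -- of the two distances is at most 1.
  rcases le_or_gt (dist (pos a) (pos c)) 1 with h | h
  · have := isKNeighbor_of_dist_le hk h hcd
    exact ⟨.inl this.1, .inl this.2⟩
  · have := isKNeighbor_of_dist_le hk (a := b) (by linarith) hcd.symm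
    exact ⟨.inr this.2, .inr this.1⟩

/-- Stewart's theorem. For a chord `ab` of a circle about `p` it says that the point has power
-st|ab|². -/
lemma dist_sq_combo (p a b : Plane) (s t : ℝ) (hst : s + t = 1) :
    dist p (s • a + t • b) ^ 2 =
      s * dist p a ^ 2 + t * dist p b ^ 2 - s * t * dist a b ^ 2 := by
  obtain rfl : s = 1 - t := by linarith
  simp only [EuclideanSpace.dist_eq, Fin.sum_univ_two, Real.dist_eq, sq_abs]
  rw [Real.sq_sqrt (by positivity), Real.sq_sqrt (by positivity), Real.sq_sqrt (by positivity),
    Real.sq_sqrt (by positivity)]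
  simp
  ring

/-- Chords of two circles that cross, where each circle has the endpoints of the other chord
outside its interior, belong to the same circle. -/
lemma dist_eq_of_crossing {a b c d x p q : Plane} (hx : x ∈ openSegment ℝ a b)
    (hx' : x ∈ openSegment ℝ c d) (hp : dist p a = dist p b) (hq : dist q c = dist q d)
    (hpc : dist p a ≤ dist p c) (hpd : dist p a ≤ dist p d) (hqa : dist q c ≤ dist q a)
    (hqb : dist q c ≤ dist q b) : dist p c = dist p a ∧ dist p d = dist p a := by
  obtain ⟨s, t, hs, ht, hst, rfl⟩ := hx
  obtain ⟨s', t', hs', ht', hst', hxx⟩ := hx'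
  -- Compute the power of the crossing point for both circles. As `c` and `d` are not inside the
  -- first, st|ab|² ≤ s't'|cd|²; the second circle gives the reverse. Equality forces `c` and `d`
  -- onto the first circle.
  have e1 := dist_sq_combo p a b s t hst
  have e2 := dist_sq_combo q a b s t hst
  have e3 := dist_sq_combo p c d s' t' hst'
  have e4 := dist_sq_combo q c d s' t' hst'
  rw [hxx] at e3 e4
  rw [← hp] at e1
  rw [← hq] at e4
  have sq : ∀ {u v : ℝ}, 0 ≤ u → u ≤ v → u ^ 2 ≤ v ^ 2 := fun h h' => pow_le_pow_left₀ h h' 2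
  have i1 := mul_le_mul_of_nonneg_left (sq dist_nonneg hpc) hs'.le
  have i2 := mul_le_mul_of_nonneg_left (sq dist_nonneg hpd) ht'.le
  have i3 := mul_le_mul_of_nonneg_left (sq dist_nonneg hqa) hs.le
  have i4 := mul_le_mul_of_nonneg_left (sq dist_nonneg hqb) ht.le
  have j1 : s * dist p a ^ 2 + t * dist p a ^ 2 = dist p a ^ 2 := by rw [← add_mul, hst, one_mul]
  have j2 : s' * dist p a ^ 2 + t' * dist p a ^ 2 = dist p a ^ 2 := by
    rw [← add_mul, hst', one_mul]
  have j3 : s * dist q c ^ 2 + t * dist q c ^ 2 = dist q c ^ 2 := by rw [← add_mul, hst, one_mul]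
  have j4 : s' * dist q c ^ 2 + t' * dist q c ^ 2 = dist q c ^ 2 := by
    rw [← add_mul, hst', one_mul]
  have k1 : s' * dist p c ^ 2 = s' * dist p a ^ 2 := by linarith
  have k2 : t' * dist p d ^ 2 = t' * dist p a ^ 2 := by linarith
  constructor
  · exact (pow_left_inj₀ dist_nonneg dist_nonneg two_ne_zero).1 (mul_left_cancel₀ hs'.ne' k1)
  · exact (pow_left_inj₀ dist_nonneg dist_nonneg two_ne_zero).1 (mul_left_cancel₀ ht'.ne' k2)

/-- A node interior to a chord is strictly inside the circle, and it is within one hop of `a`, where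
the circle is known to be empty. -/
lemma localizedDelaunay.node {V : Type*} {pos : V → Plane} (hpos : Function.Injective pos) {k : ℕ}
    (hk : 2 ≤ k) {a b v : V} (h : (localizedDelaunay pos k).Adj a b)
    (hv : pos v ∈ segment ℝ (pos a) (pos b)) : v = a ∨ v = b := by
  obtain ⟨hu, p, hp, hf⟩ := exists_circle h
  by_contra! hne
  have hav : (unitDiskGraph pos).Adj a v := by
    refine ⟨hne.1.symm, ?_⟩
    have := dist_add_dist_of_mem_segment hv
    have := hu.2
    have := dist_nonneg (x := pos v) (y := pos b)
    linarith
  have h1 := hf v (.inl (isKNeighbor_of_adj (by omega) hav))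
  obtain ⟨s, t, hs, ht, hst, hx⟩ :=
    mem_openSegment_of_ne_left_right (hpos.ne hne.1.symm) (hpos.ne hne.2.symm) hv
  have e := dist_sq_combo p (pos a) (pos b) s t hst
  rw [hx, ← hp, ← add_mul, hst, one_mul] at e
  have h2 := pow_le_pow_left₀ dist_nonneg h1 2
  have h3 : 0 < dist (pos a) (pos b) := dist_pos.2 (hpos.ne hu.1)
  have : 0 < s * t * dist (pos a) (pos b) ^ 2 := by positivity
  linarith

/-- Two segments from a point that overlap lie one inside the other. -/
lemma mem_segment_of_mem_openSegment {a b d x : Plane} (hx : x ∈ openSegment ℝ a b)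
    (hx' : x ∈ openSegment ℝ a d) : d ∈ segment ℝ a b ∨ b ∈ segment ℝ a d := by
  rw [openSegment_eq_image'] at hx hx'
  obtain ⟨s, ⟨hs, -⟩, rfl⟩ := hx
  obtain ⟨t, ⟨ht, -⟩, hst⟩ := hx'
  have hst : t • (d - a) = s • (b - a) := by simpa using hst
  rw [segment_eq_image', segment_eq_image']
  rcases le_total s t with h | h
  · refine .inl ⟨s / t, ⟨by positivity, (div_le_one ht).2 h⟩, ?_⟩
    have : (s / t) • (b - a) = d - a := by
      rw [div_eq_inv_mul, mul_smul, ← hst, smul_smul, inv_mul_cancel₀ ht.ne', one_smul]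
    simp [this]
  · refine .inr ⟨t / s, ⟨by positivity, (div_le_one hs).2 h⟩, ?_⟩
    have : (t / s) • (d - a) = b - a := by
      rw [div_eq_inv_mul, mul_smul, hst, smul_smul, inv_mul_cancel₀ hs.ne', one_smul]
    simp [this]

/-- Edges with a common endpoint that overlap would have a node on an edge. For four distinct
endpoints, the ends of each edge are near the other edge, so both empty circles apply and
`dist_eq_of_crossing` makes the endpoints cocircular. -/
theorem localizedDelaunay.isNoncrossing {V : Type*} {pos : V → Plane}
    (hpos : Function.Injective pos) (hco : NoFourCocircular pos) {k : ℕ} (hk : 2 ≤ k) :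
    IsNoncrossing pos (localizedDelaunay pos k) := by
  have share : ∀ a b d, (localizedDelaunay pos k).Adj a b → (localizedDelaunay pos k).Adj a d →
      ∀ x ∈ openSegment ℝ (pos a) (pos b), x ∈ openSegment ℝ (pos a) (pos d) → b = d := by
    intro a b d hab had x hx hx'
    rcases mem_segment_of_mem_openSegment hx hx' with h | h
    · rcases localizedDelaunay.node hpos hk hab h with rfl | rfl
      · exact absurd rfl had.ne
      · rfl
    · rcases localizedDelaunay.node hpos hk had h with rfl | rfl
      · exact absurd rfl hab.ne
      · rfl
  refine ⟨fun a b v h => localizedDelaunay.node hpos hk h, ?_⟩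
  intro a b c d hab hcd hne x hx hx'
  have hac : a ≠ c := by
    rintro rfl
    exact hne (by rw [share a b d hab hcd x hx hx'])
  have had : a ≠ d := by
    rintro rfl
    rw [openSegment_symm ℝ (pos c)] at hx'
    exact hne (by rw [share a b c hab hcd.symm x hx hx', Sym2.eq_swap])
  have hbc : b ≠ c := by
    rintro rfl
    rw [openSegment_symm ℝ (pos a)] at hx
    exact hne (by rw [share b a d hab.symm hcd x hx hx', Sym2.eq_swap])
  have hbd : b ≠ d := by
    rintro rfl
    rw [openSegment_symm ℝ (pos a)] at hx
    rw [openSegment_symm ℝ (pos c)] at hx'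
    exact hne (by rw [share b a c hab.symm hcd.symm x hx hx'])
  obtain ⟨hu, p, hp, hf⟩ := exists_circle hab
  obtain ⟨hu', q, hq, hf'⟩ := exists_circle hcd
  have m1 := openSegment_subset_segment _ _ _ hx
  have m2 := openSegment_subset_segment _ _ _ hx'
  obtain ⟨n1, n2⟩ := isKNeighbor_of_mem_segment hk hu hu' m1 m2
  obtain ⟨n3, n4⟩ := isKNeighbor_of_mem_segment hk hu' hu m2 m1
  obtain ⟨hc, hd⟩ := dist_eq_of_crossing hx hx' hp hq (hf _ n1) (hf _ n2) (hf' _ n3) (hf' _ n4)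
  have hsub : ({a, b, c, d} : Set V) ⊆ {v | dist p (pos v) = dist p (pos a)} := by
    rintro v (rfl | rfl | rfl | rfl)
    exacts [rfl, hp.symm, hc, hd]
  have hcard : ({a, b, c, d} : Set V).encard = 4 := by
    rw [Set.encard_insert_of_notMem, Set.encard_insert_of_notMem, Set.encard_pair hcd.ne]
    · norm_num
    · simp [hbc, hbd]
    · simp [hab.ne, hac, had]
  have := (Set.encard_le_encard hsub).trans (hco p (dist p (pos a)))
  rw [hcard] at this
  exact absurd this (by decide)

theorem IsStartGraph.isNoncrossing {V : Type*} {pos : V → Plane} (hpos : Function.Injective pos)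
    {D : SimpleGraph V} (hD : IsStartGraph pos D) : IsNoncrossing pos D := by
  obtain ⟨T, hT, rfl⟩ | ⟨hco, k, hk, rfl⟩ := hD
  · exact (hT.1.1.isNoncrossing hpos).mono inf_le_left
  · exact localizedDelaunay.isNoncrossing hpos hco hk

lemma IsStartGraph.le_unitDiskGraph {V : Type*} {pos : V → Plane} {D : SimpleGraph V}
    (hD : IsStartGraph pos D) : D ≤ unitDiskGraph pos := by
  obtain ⟨T, -, rfl⟩ | ⟨-, k, -, rfl⟩ := hD
  · exact inf_le_right
  · exact fun _ _ h => (localizedDelaunay.exists_circle h).1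

/-! ### The ordered Yao structure has maximum degree at most 25 -/

lemma norm_dir (θ : ℝ) : ‖dir θ‖ = 1 := by
  simp [dir, EuclideanSpace.norm_eq]

/-- Directions fix angles only modulo 2π. All angles of a cone division lie in one window of length
2π, and there this lemma makes them unique. -/
lemma OnRay.angle_eq {p q : Plane} {φ ψ : ℝ} (h : OnRay p φ q) (h' : OnRay p ψ q)
    (hd : |φ - ψ| < 2 * Real.pi) : φ = ψ := by
  obtain ⟨t, ht, rfl⟩ := h
  obtain ⟨s, hs, h⟩ := h'
  have h : t • dir φ = s • dir ψ := add_left_cancel h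
  have hts : t = s := by
    have := congrArg norm h
    rwa [norm_smul, norm_smul, norm_dir, norm_dir, mul_one, mul_one, Real.norm_of_nonneg ht.le,
      Real.norm_of_nonneg hs.le] at this
  subst hts
  have h := smul_right_injective Plane ht.ne' h
  have hc : Real.cos φ = Real.cos ψ := by simpa [dir] using congrArg (fun q : Plane => q 0) h
  have hs : Real.sin φ = Real.sin ψ := by simpa [dir] using congrArg (fun q : Plane => q 1) h
  obtain ⟨n, hn⟩ := Real.Angle.angle_eq_iff_two_pi_dvd_sub.1 (Real.Angle.cos_sin_inj hc hs)
  rw [hn, abs_mul, abs_of_pos Real.two_pi_pos] at hd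
  have h1 : |(n : ℝ)| < 1 := by
    have := Real.two_pi_pos
    nlinarith
  have h2 : n = 0 := Int.abs_lt_one_iff.1 (by exact_mod_cast h1)
  rw [h2] at hn
  simpa [sub_eq_zero] using hn

lemma OnRay.mem_segment_or {p q q' : Plane} {θ : ℝ} (h : OnRay p θ q) (h' : OnRay p θ q') :
    q ∈ segment ℝ p q' ∨ q' ∈ segment ℝ p q := by
  obtain ⟨t, ht, rfl⟩ := h
  obtain ⟨s, hs, rfl⟩ := h'
  rw [segment_eq_image', segment_eq_image']
  rcases le_total t s with h | h
  · refine .inl ⟨t / s, ⟨by positivity, (div_le_one hs).2 h⟩, ?_⟩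
    simp [smul_smul, div_mul_cancel₀ _ hs.ne']
  · refine .inr ⟨s / t, ⟨by positivity, (div_le_one ht).2 h⟩, ?_⟩
    simp [smul_smul, div_mul_cancel₀ _ ht.ne']

/-- A node of a noncrossing graph has at most one neighbor in every direction. -/
lemma IsNoncrossing.eq_of_onRay {V : Type*} {pos : V → Plane} {F : SimpleGraph V}
    (hF : IsNoncrossing pos F) {v x y : V} (hx : F.Adj v x) (hy : F.Adj v y) {θ : ℝ}
    (h : OnRay (pos v) θ (pos x)) (h' : OnRay (pos v) θ (pos y)) : x = y := by
  rcases h.mem_segment_or h' with h | h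
  · exact (hF.node v y x hy h).resolve_left hx.ne'
  · exact ((hF.node v x y hx h).resolve_left hy.ne').symm

lemma le_of_lt_succ_of_le {f : ℕ → ℝ} {n : ℕ} (h : ∀ i < n, f i < f (i + 1)) {i j : ℕ}
    (hij : i ≤ j) (hj : j ≤ n) : f i ≤ f j := by
  induction j, hij using Nat.le_induction with
  | base => exact le_rfl
  | succ j _ ih => exact (ih (by omega)).trans (h j (by omega)).le

/-! ### Counting the cones at a node. -/

namespace ConeDivision

variable {V : Type*} {pos : V → Plane} {v : V} {P : Set V} (K : ConeDivision pos v P)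

lemma ray_le {i j : ℕ} (hij : i ≤ j) (hj : j ≤ K.numSectors) : K.ray i ≤ K.ray j :=
  le_of_lt_succ_of_le K.ray_lt hij hj

lemma ray_lt_ray {i j : ℕ} (hij : i < j) (hj : j ≤ K.numSectors) : K.ray i < K.ray j :=
  (K.ray_lt i (hij.trans_le hj)).trans_le (K.ray_le hij hj)

/-- Each cone lies in a sector. -/
lemma IsCone.exists_sector {K : ConeDivision pos v P} {θ : ℝ × ℝ} (h : K.IsCone θ) :
    ∃ i < K.numSectors, K.ray i ≤ θ.1 ∧ θ.2 ≤ K.ray (i + 1) := by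
  obtain ⟨i, hi, j, hj, rfl⟩ := h
  have hm := K.cut_lt i hi
  refine ⟨i, hi, ?_, ?_⟩
  · rw [← K.cut_first i hi]
    exact le_of_lt_succ_of_le hm (Nat.zero_le _) hj.le
  · rw [← K.cut_last i hi]
    exact le_of_lt_succ_of_le hm hj le_rfl

lemma IsCone.bounds {K : ConeDivision pos v P} {θ : ℝ × ℝ} (h : K.IsCone θ) :
    K.ray 0 ≤ θ.1 ∧ θ.2 ≤ K.ray 0 + 2 * Real.pi := by
  obtain ⟨i, hi, h1, h2⟩ := h.exists_sector
  exact ⟨(K.ray_le (Nat.zero_le _) hi.le).trans h1,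
    (h2.trans (K.ray_le hi le_rfl)).trans K.ray_full.le⟩

/-- The cones are open: they miss the nodes that define the division. -/
lemma IsCone.notMem {K : ConeDivision pos v P} {θ : ℝ × ℝ} (h : K.IsCone θ) {x : V}
    (hx : pos x ∈ openCone (pos v) θ.1 θ.2) : x ∉ P := by
  intro hxP
  obtain ⟨φ, h1, h2, hφ⟩ := hx
  obtain ⟨i, hi, hr⟩ := K.ray_cover x hxP
  obtain ⟨m, hm, h3, h4⟩ := h.exists_sector
  have h5 := h.bounds
  have h6 := K.ray_le (Nat.zero_le i) hi.le
  have h7 := K.ray_lt_ray hi le_rfl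
  rw [K.ray_full] at h7
  have : φ = K.ray i := hφ.angle_eq hr (abs_lt.2 ⟨by linarith, by linarith⟩)
  rcases le_or_gt i m with him | him
  · have := K.ray_le him hm.le
    linarith
  · have := K.ray_le (Nat.succ_le_of_lt him) hi.le
    rw [Nat.succ_eq_add_one] at this
    linarith

/-- Each sector starts at a ray through a node of `P`, and the starting angles are distinct in a
half-open window of length 2π. -/
lemma numSectors_le [Finite V] (hP : P.Nonempty) : K.numSectors ≤ P.ncard := by
  have : Nonempty V := ⟨hP.some⟩
  choose! f hf hr using K.ray_mem hP
  rw [← Finset.card_range K.numSectors, ← Set.ncard_coe_finset]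
  refine Set.ncard_le_ncard_of_injOn f ?_ ?_ (Set.toFinite _)
  · intro i hi
    exact hf i (by simpa using hi)
  · intro i hi j hj hij
    have hi : i < K.numSectors := by simpa using hi
    have hj : j < K.numSectors := by simpa using hj
    have hri := hr i hi
    rw [hij] at hri
    have b1 := K.ray_le (Nat.zero_le i) hi.le
    have b2 := K.ray_lt_ray hi le_rfl
    have b3 := K.ray_le (Nat.zero_le j) hj.le
    have b4 := K.ray_lt_ray hj le_rfl
    rw [K.ray_full] at b2 b4
    have he := hri.angle_eq (hr j hj) (abs_lt.2 ⟨by linarith, by linarith⟩)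
    rcases lt_trichotomy i j with h | h | h
    · exact absurd he (K.ray_lt_ray h hj.le).ne
    · exact h
    · exact absurd he (K.ray_lt_ray h hi.le).ne'

/-- Rounding up costs less than 1 per sector, and the quotients add up to 2π / (π/3) = 6. The strict
inequality is what makes five sectors give 10 cones and not 11. -/
lemma sum_cones_lt : ∑ i ∈ Finset.range K.numSectors,
    ⌈(K.ray (i + 1) - K.ray i) / (Real.pi / 3)⌉₊ < 6 + K.numSectors := by
  have hpi := Real.pi_pos
  have h1 : ∑ i ∈ Finset.range K.numSectors,
      (⌈(K.ray (i + 1) - K.ray i) / (Real.pi / 3)⌉₊ : ℝ) <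
        ∑ i ∈ Finset.range K.numSectors, ((K.ray (i + 1) - K.ray i) / (Real.pi / 3) + 1) := by
    refine Finset.sum_lt_sum_of_nonempty ⟨0, Finset.mem_range.2 K.numSectors_pos⟩ fun i hi => ?_
    refine Nat.ceil_lt_add_one (div_nonneg (sub_nonneg.2 ?_) (by positivity))
    exact (K.ray_lt i (Finset.mem_range.1 hi)).le
  rw [Finset.sum_add_distrib, ← Finset.sum_div, Finset.sum_range_sub, K.ray_full] at h1
  have h2 : (K.ray 0 + 2 * Real.pi - K.ray 0) / (Real.pi / 3) = 6 := by
    field_simp; ring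
  rw [h2] at h1
  have h3 : ((∑ i ∈ Finset.range K.numSectors,
    ⌈(K.ray (i + 1) - K.ray i) / (Real.pi / 3)⌉₊ : ℕ) : ℝ) < ((6 + K.numSectors : ℕ) : ℝ) := by
    push_cast
    simpa using h1
  exact_mod_cast h3

/-- At most five rays lead to at most ten cones. -/
lemma exists_cones [Finite V] (hP : P.ncard ≤ 5) :
    ∃ S : Finset (ℝ × ℝ), S.card ≤ 10 ∧ ∀ θ, K.IsCone θ → θ ∈ S := by
  classical
  refine ⟨((Finset.range K.numSectors).sigma fun i =>
    Finset.range ⌈(K.ray (i + 1) - K.ray i) / (Real.pi / 3)⌉₊).image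
      fun e => (K.cut e.1 e.2, K.cut e.1 (e.2 + 1)), ?_, ?_⟩
  · refine Finset.card_image_le.trans ?_
    rw [Finset.card_sigma]
    simp only [Finset.card_range]
    have h1 := K.sum_cones_lt
    have h2 : K.numSectors ≤ 5 := by
      rcases P.eq_empty_or_nonempty with h | h
      · rw [K.one_sector h]; norm_num
      · exact (K.numSectors_le h).trans hP
    omega
  · rintro θ ⟨i, hi, j, hj, rfl⟩
    exact Finset.mem_image.2 ⟨⟨i, j⟩, by simpa using ⟨hi, hj⟩, rfl⟩

end ConeDivision

/-! ### Counting the edges of an ordered Yao structure at a node. -/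

section Yao

variable {V : Type*} {pos : V → Plane} {F : SimpleGraph V}

lemma IsConsecutive.mem_left {v x y : V} {θ : ℝ × ℝ} (h : IsConsecutive pos F v θ x y) :
    x ∈ coneNeighbors pos F v θ := by
  obtain ⟨hx, -, φ, ψ, h1, h2, h3, h4, -⟩ := h
  exact ⟨hx, φ, h1, h2.trans h3, h4⟩

lemma IsConsecutive.mem_right {v x y : V} {θ : ℝ × ℝ} (h : IsConsecutive pos F v θ x y) :
    y ∈ coneNeighbors pos F v θ := by
  obtain ⟨-, hy, φ, ψ, h1, h2, h3, -, h5, -⟩ := h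
  exact ⟨hy, ψ, h1.trans h2, h3, h5⟩

/-- Seen from `v`, the node `x` has one angle in the window of the division, whichever cone is used;
the next occupied angle is then determined, and it carries one neighbor. -/
lemma IsConsecutive.next_unique (hF : IsNoncrossing pos F) {v : V} {P : Set V}
    {K : ConeDivision pos v P} {θ θ' : ℝ × ℝ} (hθ : K.IsCone θ) (hθ' : K.IsCone θ') {x y y' : V}
    (h : IsConsecutive pos F v θ x y) (h' : IsConsecutive pos F v θ' x y') : y = y' := by
  obtain ⟨-, hy, φ, ψ, h1, h2, h3, h4, h5, h6⟩ := h
  obtain ⟨-, hy', φ', ψ', h1', h2', h3', h4', h5', h6'⟩ := h'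
  have b := hθ.bounds
  have b' := hθ'.bounds
  obtain rfl : φ = φ' := h4.angle_eq h4' (abs_lt.2 ⟨by linarith, by linarith⟩)
  rcases lt_trichotomy ψ ψ' with h | rfl | h
  · exact absurd h5 (h6' y hy ψ h2 h)
  · exact hF.eq_of_onRay hy hy' h5 h5'
  · exact absurd h5' (h6 y' hy' ψ' h2' h)

lemma IsConsecutive.prev_unique (hF : IsNoncrossing pos F) {v : V} {P : Set V}
    {K : ConeDivision pos v P} {θ θ' : ℝ × ℝ} (hθ : K.IsCone θ) (hθ' : K.IsCone θ') {x x' y : V}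
    (h : IsConsecutive pos F v θ x y) (h' : IsConsecutive pos F v θ' x' y) : x = x' := by
  obtain ⟨hx, -, φ, ψ, h1, h2, h3, h4, h5, h6⟩ := h
  obtain ⟨hx', -, φ', ψ', h1', h2', h3', h4', h5', h6'⟩ := h'
  have b := hθ.bounds
  have b' := hθ'.bounds
  obtain rfl : ψ = ψ' := h5.angle_eq h5' (abs_lt.2 ⟨by linarith, by linarith⟩)
  rcases lt_trichotomy φ φ' with h | rfl | h
  · exact absurd h4' (h6 x' hx' φ' h h2')
  · exact hF.eq_of_onRay hx hx' h4 h4'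
  · exact absurd h4 (h6' x hx φ h h2)

/-- In the order of the Yao method on a plane graph, at most five neighbors of a node are processed
before it. -/
lemma IsYaoOrder.ncard_processedNeighbors_le [Fintype V] (hpos : Function.Injective pos)
    (hF : IsNoncrossing pos F) {ID : V → ℕ} {ord : V ≃ Fin (Fintype.card V)}
    (hord : IsYaoOrder ID F ord) (v : V) : (processedNeighbors F ord v).ncard ≤ 5 := by
  classical
  -- These are the nodes that remain when `v` is removed. The graph they induce has a node `w` of
  -- degree at most 5, and `v` has smallest degree in it.
  let W := {x // ord x ≤ ord v}
  have : Nonempty W := ⟨⟨v, le_rfl⟩⟩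
  have hW : IsNoncrossing (fun x : W => pos x) (F.comap Subtype.val) := by
    refine ⟨fun a b x hab hx => ?_, fun a b c d hab hcd hne => ?_⟩
    · exact (hF.node a b x hab hx).imp Subtype.ext Subtype.ext
    · refine hF.cross a b c d hab hcd fun h => hne ?_
      rw [Sym2.eq_iff] at h ⊢
      exact h.imp (fun h => ⟨Subtype.ext h.1, Subtype.ext h.2⟩)
        (fun h => ⟨Subtype.ext h.1, Subtype.ext h.2⟩)
  obtain ⟨w, hw⟩ := hW.exists_degree_le_five (hpos.comp Subtype.val_injective)
  have h1 : ({x | F.Adj w x ∧ ord x ≤ ord v} : Set V).ncard ≤ 5 := by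
    refine le_trans ?_ hw
    rw [← Set.ncard_image_of_injective _ Subtype.val_injective]
    refine Set.ncard_le_ncard ?_ (Set.toFinite _)
    rintro x ⟨hx, hxv⟩
    exact ⟨⟨x, hxv⟩, hx, rfl⟩
  have h2 : ({x | F.Adj v x ∧ ord x ≤ ord v} : Set V).ncard ≤
      ({x | F.Adj w x ∧ ord x ≤ ord v} : Set V).ncard := by
    have := hord v w w.2
    rw [Prod.Lex.toLex_le_toLex] at this
    rcases this with h | h
    · exact h.le
    · exact h.1.le
  refine le_trans (Set.ncard_le_ncard ?_ (Set.toFinite _)) (h2.trans h1)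
  exact fun x hx => ⟨hx.1, hx.2.le⟩

/-- Had `v` been processed before `u`, it would lie on a ray bounding the sectors at `u`, and the
open cones miss those rays. -/
lemma mem_processedNeighbors_of_mem_cone [Fintype V] {ord : V ≃ Fin (Fintype.card V)} {u v : V}
    {K : ConeDivision pos u (processedNeighbors F ord u)} {θ : ℝ × ℝ} (hθ : K.IsCone θ)
    (h : v ∈ coneNeighbors pos F u θ) : u ∈ processedNeighbors F ord v := by
  refine ⟨h.1.symm, lt_of_le_of_ne ?_ (ord.injective.ne h.1.ne)⟩
  by_contra! hlt
  exact hθ.notMem h.2 ⟨h.1, hlt⟩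

theorem IsOrderedYao.ncard_neighborSet_le [Fintype V] (hpos : Function.Injective pos)
    (hF : IsNoncrossing pos F) {ID : V → ℕ} {F' : SimpleGraph V} (h : IsOrderedYao pos ID F F')
    (v : V) : (F'.neighborSet v).ncard ≤ 25 := by
  classical
  obtain ⟨ord, hord, K, sel, hsel, rfl⟩ := h
  have h5 := hord.ncard_processedNeighbors_le hpos hF
  obtain ⟨S, hS, hcone⟩ := (K v).exists_cones (h5 v)
  set P := (processedNeighbors F ord v).toFinset with hP
  have hP5 : P.card ≤ 5 := by
    rw [hP, ← Set.ncard_eq_toFinset_card']; exact h5 v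
  set next : V → Finset V := fun u =>
    Finset.univ.filter fun y => ∃ θ, (K u).IsCone θ ∧ IsConsecutive pos F u θ v y with hnext
  set prev : V → Finset V := fun u =>
    Finset.univ.filter fun y => ∃ θ, (K u).IsCone θ ∧ IsConsecutive pos F u θ y v with hprev
  have hnext1 : ∀ u, (next u).card ≤ 1 := by
    intro u
    refine Finset.card_le_one.2 fun y hy y' hy' => ?_
    simp only [hnext, Finset.mem_filter, Finset.mem_univ, true_and] at hy hy'
    obtain ⟨θ, hθ, h⟩ := hy
    obtain ⟨θ', hθ', h'⟩ := hy'
    exact h.next_unique hF hθ hθ' h'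
  have hprev1 : ∀ u, (prev u).card ≤ 1 := by
    intro u
    refine Finset.card_le_one.2 fun y hy y' hy' => ?_
    simp only [hprev, Finset.mem_filter, Finset.mem_univ, true_and] at hy hy'
    obtain ⟨θ, hθ, h⟩ := hy
    obtain ⟨θ', hθ', h'⟩ := hy'
    exact h.prev_unique hF hθ hθ' h'
  -- All possible neighbors of `v`: selections in the cones at `v`, and, for each earlier neighbor
  -- `u`, the node `u` and the nodes next to `v` around `u`.
  set T := S.image (sel v) ∪ P.biUnion fun u => {u} ∪ next u ∪ prev u with hT
  have hcard : T.card ≤ 25 := by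
    have h1 : (S.image (sel v)).card ≤ 10 := Finset.card_image_le.trans hS
    have h2 : (P.biUnion fun u => {u} ∪ next u ∪ prev u).card ≤ P.card * 3 := by
      refine Finset.card_biUnion_le_card_mul _ _ _ fun u _ => ?_
      have a1 := Finset.card_union_le ({u} ∪ next u) (prev u)
      have a2 := Finset.card_union_le {u} (next u)
      have a3 := hnext1 u
      have a4 := hprev1 u
      rw [Finset.card_singleton] at a2
      omega
    have h3 := Finset.card_union_le (S.image (sel v)) (P.biUnion fun u => {u} ∪ next u ∪ prev u)
    rw [← hT] at h3
    omega
  refine le_trans ?_ hcard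
  rw [← Set.ncard_coe_finset]
  refine Set.ncard_le_ncard ?_ (Finset.finite_toSet _)
  intro y hy
  rw [SimpleGraph.mem_neighborSet, SimpleGraph.fromEdgeSet_adj] at hy
  obtain ⟨⟨u, θ, hθ, ⟨hne, he⟩ | ⟨x, x', hc, he⟩⟩, -⟩ := hy
  · rcases Sym2.eq_iff.1 he with ⟨rfl, rfl⟩ | ⟨h1, rfl⟩
    · exact Finset.mem_union_left _ (Finset.mem_image_of_mem _ (hcone θ hθ))
    · have hv := (hsel y θ hθ hne).1
      rw [← h1] at hv
      refine Finset.mem_union_right _ (Finset.mem_biUnion.2 ⟨y, ?_, by simp⟩)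
      rw [hP, Set.mem_toFinset]
      exact mem_processedNeighbors_of_mem_cone hθ hv
  · rcases Sym2.eq_iff.1 he with ⟨rfl, rfl⟩ | ⟨rfl, rfl⟩
    · refine Finset.mem_union_right _ (Finset.mem_biUnion.2 ⟨u, ?_, ?_⟩)
      · rw [hP, Set.mem_toFinset]
        exact mem_processedNeighbors_of_mem_cone hθ hc.mem_left
      · refine Finset.mem_union_left _ (Finset.mem_union_right _ ?_)
        simpa [hnext] using ⟨_, _, hθ, hc⟩
    · refine Finset.mem_union_right _ (Finset.mem_biUnion.2 ⟨u, ?_, ?_⟩)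
      · rw [hP, Set.mem_toFinset]
        exact mem_processedNeighbors_of_mem_cone hθ hc.mem_right
      · refine Finset.mem_union_right _ ?_
        simpa [hprev] using ⟨_, _, hθ, hc⟩

/-- Every node that meets an edge of the output meets an edge of the input. -/
lemma IsOrderedYao.exists_adj [Fintype V] {ID : V → ℕ} {F' : SimpleGraph V}
    (h : IsOrderedYao pos ID F F') {v y : V} (hy : F'.Adj v y) : ∃ u, F.Adj v u := by
  obtain ⟨ord, hord, K, sel, hsel, rfl⟩ := h
  rw [SimpleGraph.fromEdgeSet_adj] at hy
  obtain ⟨⟨u, θ, hθ, ⟨hne, he⟩ | ⟨x, x', hc, he⟩⟩, -⟩ := hy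
  · have := (hsel u θ hθ hne).1.1
    rcases Sym2.eq_iff.1 he with ⟨rfl, -⟩ | ⟨rfl, -⟩
    · exact ⟨_, this⟩
    · exact ⟨_, this.symm⟩
  · rcases Sym2.eq_iff.1 he with ⟨rfl, -⟩ | ⟨rfl, -⟩
    · exact ⟨u, hc.mem_left.1.symm⟩
    · exact ⟨u, hc.mem_right.1.symm⟩

end Yao

/-! ### Cells near a node -/

lemma card_Icc_ceil_floor_le {A B : ℝ} (h : 0 ≤ B - A + 1) :
    ((Finset.Icc ⌈A⌉ ⌊B⌋).card : ℝ) ≤ B - A + 1 := by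
  rw [Int.card_Icc]
  rcases le_total 0 (⌊B⌋ + 1 - ⌈A⌉) with h1 | h1
  · have : (((⌊B⌋ + 1 - ⌈A⌉).toNat : ℤ) : ℝ) = ((⌊B⌋ + 1 - ⌈A⌉ : ℤ) : ℝ) := by
      rw [Int.toNat_of_nonneg h1]
    rw [← Int.cast_natCast, this]
    push_cast
    linarith [Int.floor_le B, Int.le_ceil A]
  · rw [Int.toNat_of_nonpos h1]
    simpa using h

/-- The multiples of `s` in an interval of length at most `2 + β`. -/
lemma exists_finset_int {β s A : ℝ} (hβ : 0 < β) (hβ1 : β ≤ 1) (hs : β / 2 < s) :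
    ∃ S : Finset ℤ, (S.card : ℝ) ≤ 7 / β ∧ ∀ i : ℤ, A ≤ i * s → i * s ≤ A + (2 + β) → i ∈ S := by
  have hs0 : 0 < s := by linarith
  have hq : (A + (2 + β)) / s - A / s = (2 + β) / s := by ring
  refine ⟨Finset.Icc ⌈A / s⌉ ⌊(A + (2 + β)) / s⌋, ?_, ?_⟩
  · refine (card_Icc_ceil_floor_le ?_).trans ?_ <;> rw [hq]
    · positivity
    · have h1 : (2 + β) / s ≤ (2 + β) / (β / 2) :=
        div_le_div_of_nonneg_left (by linarith) (by linarith) hs.le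
      have h2 : (2 + β) / (β / 2) = (4 + 2 * β) / β := by field_simp; ring
      have h3 : (4 + 2 * β) / β + 1 ≤ 7 / β := by
        rw [div_add_one hβ.ne']
        exact div_le_div_of_nonneg_right (by linarith) hβ.le
      linarith
  · intro i h1 h2
    rw [Finset.mem_Icc, Int.ceil_le, Int.le_floor, div_le_iff₀ hs0, le_div_iff₀ hs0]
    exact ⟨h1, h2⟩

lemma abs_sub_coord_le_dist (p q : Plane) (i : Fin 2) : |p i - q i| ≤ dist p q := by
  rw [dist_eq_norm]
  simpa using PiLp.norm_apply_le (p - q) i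

/-- At most `49 / β²` cells contain a point within distance `1` of a given point. -/
lemma exists_cells_near {β δ : ℝ} (hβ : 0 < β) (hβ1 : β ≤ 1) (hδ : δ < β / 4) (o p : Plane) :
    ∃ S : Finset (ℤ × ℤ), (S.card : ℝ) ≤ 49 / β ^ 2 ∧
      ∀ c, ∀ q ∈ cell o β δ c, dist p q ≤ 1 → c ∈ S := by
  have hs : β / 2 < β - 2 * δ := by linarith
  -- A cell extends to the right of and downward from its reference corner, so the margin β goes
  -- below the range of the first coordinate and above that of the second.
  obtain ⟨S, hS, hS'⟩ := exists_finset_int (A := p 0 - 1 - β - o 0) hβ hβ1 hs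
  obtain ⟨T, hT, hT'⟩ := exists_finset_int (A := p 1 - 1 - o 1) hβ hβ1 hs
  refine ⟨S ×ˢ T, ?_, ?_⟩
  · rw [Finset.card_product]
    push_cast
    calc (S.card : ℝ) * T.card ≤ 7 / β * (7 / β) := by gcongr
      _ = 49 / β ^ 2 := by field_simp; norm_num
  · rintro c q ⟨h1, h2, h3, h4⟩ hd
    have e0 := abs_le.1 ((abs_sub_coord_le_dist p q 0).trans hd)
    have e1 := abs_le.1 ((abs_sub_coord_le_dist p q 1).trans hd)
    exact Finset.mem_product.2 ⟨hS' _ (by linarith) (by linarith),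
      hT' _ (by linarith) (by linarith)⟩

lemma incidentGraph_le {V : Type*} (D : SimpleGraph V) (S : Set V) : incidentGraph D S ≤ D :=
  fun _ _ h => h.1

/-! ### The output is a subgraph of the union of the ordered Yao structures -/

/-- Whatever the query answers, an edge is either deleted from `ydel` or copied from the list to
`out`, so containment in `Z` is invariant. -/
lemma foldl_greedyEdge_le {V : Type*} (pos : V → Plane) (ε : ℝ) {Z : SimpleGraph V}
    (l : List (Sym2 V)) (hl : ∀ e ∈ l, e ∈ Z.edgeSet) (S : GreedyState V) (hY : S.ydel ≤ Z)
    (hH : S.out ≤ Z) :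
    (l.foldl (greedyEdge pos ε) S).ydel ≤ Z ∧ (l.foldl (greedyEdge pos ε) S).out ≤ Z := by
  induction l generalizing S with
  | nil => exact ⟨hY, hH⟩
  | cons e l ih =>
    rw [List.foldl_cons]
    refine ih (fun f hf => hl f (List.mem_cons_of_mem _ hf)) _ ?_ ?_ <;> unfold greedyEdge <;>
      split_ifs
    · exact hY
    · exact (SimpleGraph.deleteEdges_le _).trans hY
    · refine sup_le hH fun a b h => ?_
      rw [SimpleGraph.fromEdgeSet_adj, Set.mem_singleton_iff] at h
      have := hl e List.mem_cons_self
      rwa [← h.1] at this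
    · exact hH

lemma CellSteps.le {V : Type*} {pos : V → Plane} {ID : V → ℕ} {ε : ℝ} {N : ℤ × ℤ → Set Plane}
    {cs : List (ℤ × ℤ)} {Y H Y' H' Z : SimpleGraph V} (h : CellSteps pos ID ε N cs Y H Y' H')
    (hY : Y ≤ Z) (hH : H ≤ Z) : Y' ≤ Z ∧ H' ≤ Z := by
  induction cs generalizing Y H with
  | nil =>
    obtain ⟨rfl, rfl⟩ := h
    exact ⟨hY, hH⟩
  | cons c cs ih =>
    obtain ⟨Y₁, H₁, ⟨l, -, hl, rfl, rfl⟩, h2⟩ := h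
    obtain ⟨h3, h4⟩ := foldl_greedyEdge_le pos ε (Z := Z) l
      (fun e he => SimpleGraph.edgeSet_mono hY ((hl e).1 he).1)
      ⟨Y, H, Y.deleteEdges {e | e ∈ l}⟩ hY hH
    exact ih h2 h3 h4

lemma IsRun.le_iSup {V : Type*} [Fintype V] {pos : V → Plane} {ID : V → ℕ} {ε β δ : ℝ} {o : Plane}
    {Y : ℤ × ℤ → SimpleGraph V} {H : SimpleGraph V} (h : IsRun pos ID ε β δ o Y H) :
    H ≤ ⨆ c, Y c := by
  obtain ⟨D, -, -, cs, Y₃, H₃, -, hsteps, r, centers, N, -, -, -, rfl⟩ := h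
  obtain ⟨h1, h2⟩ := hsteps.le le_rfl bot_le
  refine sup_le h2 fun a b hab => h1 ?_
  exact ((SimpleGraph.fromEdgeSet_adj _).1 hab).1.1

end PLOS

/-! ### Combining the degree bound with the count of cells. -/

theorem mainTheorem4 :
    ∃ C : ℝ, 0 < C ∧
      ∀ (V : Type*) [Fintype V] (pos : V → PLOS.Plane) (ID : V → ℕ),
        Function.Injective pos → Function.Injective ID →
      ∀ (ε β δ : ℝ), 0 < ε → 0 < β → β ≤ 1 / √2 → 0 < δ → δ < β / 4 →
      ∀ (o : PLOS.Plane) (Y : ℤ × ℤ → SimpleGraph V) (H : SimpleGraph V),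
        PLOS.IsRun pos ID ε β δ o Y H →
        -- every graph `Y c` has maximum degree at most 25
        (∀ c v, ((Y c).neighborSet v).ncard ≤ 25) ∧
        -- every node is an endpoint of an edge in at most `C / β²` of the graphs `Y c`
        (∀ v, {c | ((Y c).neighborSet v).Nonempty}.Finite ∧
          ({c | ((Y c).neighborSet v).Nonempty}.ncard : ℝ) ≤ C / β ^ 2) ∧
        -- the output has maximum degree at most `25 C / β²`
        (∀ v, ((H.neighborSet v).ncard : ℝ) ≤ 25 * (C / β ^ 2)) := by
  classical
  refine ⟨49, by norm_num, ?_⟩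
  intro V _ pos ID hpos _ ε β δ _ hβ hβ2 _ hδ o Y H hrun
  have hβ1 : β ≤ 1 := by
    refine hβ2.trans ((div_le_one (by positivity)).2 ?_)
    rw [Real.one_le_sqrt]
    norm_num
  have hle := hrun.le_iSup
  obtain ⟨D, hD, hY, -⟩ := hrun
  have hdeg : ∀ c v, ((Y c).neighborSet v).ncard ≤ 25 := fun c v =>
    (hY c).ncard_neighborSet_le hpos ((hD.isNoncrossing hpos).mono (PLOS.incidentGraph_le _ _)) v
  have hnear : ∀ v, ∃ S : Finset (ℤ × ℤ), (S.card : ℝ) ≤ 49 / β ^ 2 ∧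
      {c | ((Y c).neighborSet v).Nonempty} ⊆ (S : Set (ℤ × ℤ)) := by
    intro v
    obtain ⟨S, hS, hS'⟩ := PLOS.exists_cells_near hβ hβ1 hδ o (pos v)
    refine ⟨S, hS, ?_⟩
    rintro c ⟨y, hy⟩
    -- Even if the edge `vy` itself is new, `v` has an edge `vu` of `D` with `v` or `u` in the cell,
    -- and |vu| ≤ 1.
    obtain ⟨u, hvu, hc | hc⟩ := (hY c).exists_adj hy
    · exact hS' c _ hc (by simp)
    · exact hS' c _ hc (hD.le_unitDiskGraph hvu).2
  have hcells : ∀ v, {c | ((Y c).neighborSet v).Nonempty}.Finite ∧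
      ({c | ((Y c).neighborSet v).Nonempty}.ncard : ℝ) ≤ 49 / β ^ 2 := by
    intro v
    obtain ⟨S, hS, hsub⟩ := hnear v
    refine ⟨S.finite_toSet.subset hsub, le_trans ?_ hS⟩
    rw [← Set.ncard_coe_finset]
    exact_mod_cast Set.ncard_le_ncard hsub S.finite_toSet
  refine ⟨hdeg, hcells, fun v => ?_⟩
  obtain ⟨S, hS, hsub⟩ := hnear v
  have hcount : (H.neighborSet v).ncard ≤ S.card * 25 := by
    have h1 : H.neighborSet v ⊆ (S.biUnion fun c => ((Y c).neighborSet v).toFinset : Finset V) := by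
      intro y hy
      obtain ⟨c, hc⟩ := SimpleGraph.iSup_adj.1 (hle hy)
      exact Finset.mem_coe.2 (Finset.mem_biUnion.2 ⟨c, hsub ⟨y, hc⟩, by simpa using hc⟩)
    refine (Set.ncard_le_ncard h1 (Finset.finite_toSet _)).trans ?_
    rw [Set.ncard_coe_finset]
    refine Finset.card_biUnion_le_card_mul _ _ _ fun c _ => ?_
    rw [← Set.ncard_eq_toFinset_card']
    exact hdeg c v
  calc ((H.neighborSet v).ncard : ℝ) ≤ S.card * 25 := by exact_mod_cast hcount
    _ ≤ 25 * (49 / β ^ 2) := by linarith
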